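/- For integers $\chi_d\ge 1$ and $\Delta^*\ge 0$, a finite graph $G=(V,E)$ admits a $(\chi_d,\Delta^*)$-coloring if $V$ can be partitioned into $\chi_d$ (possibly empty) sets, each of which induces a subgraph of maximum degree at most $\Delta^*$. Defective Coloring is the problem of deciding, given $G,\chi_d,\Delta^*$, whether $G$ admits a $(\chi_d,\Delta^*)$-coloring. Write $n=|V|$ and let $\mathrm{vc}(G)$ be the minimum size of a vertex cover of $G$. Defective Coloring is fixed-parameter tractable parameterized by vertex cover: there are a computable function $f$ and an algorithm that, given $G,\chi_d,\Delta^*$, decides whether $G$ admits a $(\chi_d,\Delta^*)$-coloring in time $f(\mathrm{vc}(G))\cdot n^{O(1)}$. More precisely, there is an algorithm that, given a graph $G$, integers $\chi_d\ge 1$ and $\Delta^*\ge 0$, and a vertex cover of $G$ of size $\mathrm{vc}$, decides whether $G$ admits a $(\chi_d,\Delta^*)$-coloring in time $\mathrm{vc}^{O(\mathrm{vc})}\,n^{O(1)}$. (Time is the number of steps of a random access machine with unit-cost addition and subtraction; in the bounds, $0^0=1$, and the empty graph takes constant time.) -/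

import Mathlib

/-! ### Machine model

A random access machine: finitely many registers mentioned by the program, an unbounded memory of
natural numbers with indirect addressing, and constants, addition and truncated subtraction as the
only arithmetic. Every instruction, every test of a branch and every test of a loop costs one step.
There is no unit-cost multiplication, so step counts are polynomially related to Turing machine
time. -/

namespace RAM

/-- A machine state: registers `reg 0, reg 1, …` and memory cells `mem 0, mem 1, …`. -/
structure State where
  reg : ℕ → ℕ
  mem : ℕ → ℕ

/-- Write `v` into register `i`. -/
def State.setReg (s : State) (i v : ℕ) : State :=
  { s with reg := Function.update s.reg i v }

/-- Write `v` into memory cell `a`. -/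
def State.setMem (s : State) (a v : ℕ) : State :=
  { s with mem := Function.update s.mem a v }

/-- Programs. A program is a finite object that does not depend on the input. -/
inductive Prog where
  /-- do nothing -/
  | skip
  /-- `const i v`: register `i` becomes the constant `v` -/
  | const (i v : ℕ)
  /-- `add i j k`: register `i` becomes the sum of registers `j` and `k` -/
  | add (i j k : ℕ)
  /-- `sub i j k`: register `i` becomes register `j` minus register `k`, or `0` if negative -/
  | sub (i j k : ℕ)
  /-- `load i j`: register `i` becomes the content of the memory cell addressed by register `j` -/
  | load (i j : ℕ)
  /-- `store i j`: the memory cell addressed by register `i` becomes register `j` -/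
  | store (i j : ℕ)
  /-- sequential composition -/
  | seq (p q : Prog)
  /-- `branch i p q`: run `p` if register `i` is nonzero, otherwise run `q` -/
  | branch (i : ℕ) (p q : Prog)
  /-- `loop i p`: run `p` as long as register `i` is nonzero -/
  | loop (i : ℕ) (p : Prog)

/-- `Exec p s t s'`: program `p`, started in state `s`, halts after exactly `t` steps in
state `s'`. -/
inductive Exec : Prog → State → ℕ → State → Prop
  | skip (s : State) : Exec .skip s 1 s
  | const (i v : ℕ) (s : State) : Exec (.const i v) s 1 (s.setReg i v)
  | add (i j k : ℕ) (s : State) : Exec (.add i j k) s 1 (s.setReg i (s.reg j + s.reg k))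
  | sub (i j k : ℕ) (s : State) : Exec (.sub i j k) s 1 (s.setReg i (s.reg j - s.reg k))
  | load (i j : ℕ) (s : State) : Exec (.load i j) s 1 (s.setReg i (s.mem (s.reg j)))
  | store (i j : ℕ) (s : State) : Exec (.store i j) s 1 (s.setMem (s.reg i) (s.reg j))
  | seq {p q : Prog} {s s₁ s₂ : State} {t₁ t₂ : ℕ} :
      Exec p s t₁ s₁ → Exec q s₁ t₂ s₂ → Exec (.seq p q) s (t₁ + t₂) s₂
  | branch_pos {i : ℕ} {p q : Prog} {s s₁ : State} {t : ℕ} :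
      s.reg i ≠ 0 → Exec p s t s₁ → Exec (.branch i p q) s (t + 1) s₁
  | branch_zero {i : ℕ} {p q : Prog} {s s₁ : State} {t : ℕ} :
      s.reg i = 0 → Exec q s t s₁ → Exec (.branch i p q) s (t + 1) s₁
  | loop_pos {i : ℕ} {p : Prog} {s s₁ s₂ : State} {t₁ t₂ : ℕ} :
      s.reg i ≠ 0 → Exec p s t₁ s₁ → Exec (.loop i p) s₁ t₂ s₂ →
        Exec (.loop i p) s (t₁ + t₂ + 1) s₂
  | loop_zero {i : ℕ} {p : Prog} {s : State} :
      s.reg i = 0 → Exec (.loop i p) s 1 s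

/-- The machine is deterministic: the halting state and the step count are unique. -/
theorem Exec.unique {p : Prog} {s : State} {t t' : ℕ} {s₁ s₂ : State}
    (h : Exec p s t s₁) (h' : Exec p s t' s₂) : t = t' ∧ s₁ = s₂ := by
  induction h generalizing t' s₂ with
  | skip | const | add | sub | load | store => cases h'; exact ⟨rfl, rfl⟩
  | seq _ _ ih₁ ih₂ =>
    cases h' with
    | seq a b =>
      obtain ⟨rfl, rfl⟩ := ih₁ a
      obtain ⟨rfl, rfl⟩ := ih₂ b
      exact ⟨rfl, rfl⟩
  | branch_pos hi _ ih =>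
    cases h' with
    | branch_pos _ a => obtain ⟨rfl, rfl⟩ := ih a; exact ⟨rfl, rfl⟩
    | branch_zero h0 _ => exact absurd h0 hi
  | branch_zero hi _ ih =>
    cases h' with
    | branch_zero _ a => obtain ⟨rfl, rfl⟩ := ih a; exact ⟨rfl, rfl⟩
    | branch_pos h0 _ => exact absurd hi h0
  | loop_pos hi _ _ ih₁ ih₂ =>
    cases h' with
    | loop_pos _ a b =>
      obtain ⟨rfl, rfl⟩ := ih₁ a
      obtain ⟨rfl, rfl⟩ := ih₂ b
      exact ⟨rfl, rfl⟩
    | loop_zero h0 => exact absurd h0 hi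
  | loop_zero hi =>
    cases h' with
    | loop_zero _ => exact ⟨rfl, rfl⟩
    | loop_pos h0 _ _ => exact absurd hi h0

end RAM

/-! ### Decision problems with a parameter -/

/-- A decision problem together with the machine encoding of its instances, their size, and a
parameter. -/
structure ParamProblem where
  Inst : Type
  encode : Inst → RAM.State
  size : Inst → ℕ
  param : Inst → ℕ
  Yes : Inst → Prop

/-- The program `p` halts on every instance `x` after at most `T x` steps, with the answer
(`1` for yes, `0` for no) in register `0`. -/
def ParamProblem.DecidedInTime (P : ParamProblem) (p : RAM.Prog) (T : P.Inst → ℕ) : Prop :=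
  ∀ x : P.Inst, ∃ (t : ℕ) (s : RAM.State), RAM.Exec p (P.encode x) t s ∧ t ≤ T x ∧
    (P.Yes x → s.reg 0 = 1) ∧ (¬ P.Yes x → s.reg 0 = 0)

/-- Fixed-parameter tractability: one program decides the problem in time `f(k) · n ^ O(1)`, for a
computable function `f` of the parameter `k`. (`n + 1` in place of `n` allows for
instances of size `0`.) -/
def ParamProblem.FPT (P : ParamProblem) : Prop :=
  ∃ f : ℕ → ℕ, Computable f ∧ ∃ (C : ℕ) (p : RAM.Prog),
    P.DecidedInTime p fun x => f (P.param x) * (P.size x + 1) ^ C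

/-! ### Defective coloring -/

open Classical in
/-- `G` admits a `(χ, Δ)`-coloring: the vertices can be partitioned into `χ` (possibly empty) sets,
each of which induces a graph of maximum degree at most `Δ`. -/
def HasDefectiveColoring {V : Type} [Fintype V] (G : SimpleGraph V) (χ Δ : ℕ) : Prop :=
  ∃ c : V → Fin χ, ∀ i : Fin χ, (G.induce {v | c v = i}).maxDegree ≤ Δ

/-- An instance of Defective Coloring: a finite graph and integers `χ ≥ 1`, `Δ ≥ 0`. -/
structure DCInstance where
  n : ℕ
  G : SimpleGraph (Fin n)
  χ : ℕ
  Δ : ℕ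
  one_le_χ : 1 ≤ χ

/-- An instance of Defective Coloring together with a vertex cover of its graph. -/
structure DCCoverInstance extends DCInstance where
  S : Finset (Fin n)
  isVertexCover : G.IsVertexCover (S : Set (Fin n))

/-- The registers of the input state: `n`, `χ`, `Δ` in registers `0`, `1`, `2`. -/
def DCInstance.inputReg (x : DCInstance) : ℕ → ℕ
  | 0 => x.n
  | 1 => x.χ
  | 2 => x.Δ
  | _ => 0

open Classical in
/-- The input state: memory cell `n * i + j` holds the entry `(i, j)` of the adjacency matrix. -/
noncomputable def DCInstance.encode (x : DCInstance) : RAM.State where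
  reg := x.inputReg
  mem a := if ∃ i j : Fin x.n, x.G.Adj i j ∧ a = x.n * i + j then 1 else 0

open Classical in
/-- The input state with a vertex cover: the adjacency matrix as before, and memory cell
`n * n + i` holds `1` or `0` according to whether vertex `i` belongs to the cover. -/
noncomputable def DCCoverInstance.encode (x : DCCoverInstance) : RAM.State where
  reg := x.inputReg
  mem a := if (∃ i j : Fin x.n, x.G.Adj i j ∧ a = x.n * i + j) ∨
    (∃ i : Fin x.n, i ∈ x.S ∧ a = x.n * x.n + i) then 1 else 0

/-- Defective Coloring parameterized by the vertex cover number of the graph, which is not part of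
the input. The size of an instance is its number of vertices. -/
noncomputable def DefectiveColoring : ParamProblem where
  Inst := DCInstance
  encode := DCInstance.encode
  size x := x.n
  param x := x.G.vertexCoverNum.toNat
  Yes x := HasDefectiveColoring x.G x.χ x.Δ

/-- Defective Coloring with a given vertex cover, parameterized by the size of that cover. -/
noncomputable def DefectiveColoringWithCover : ParamProblem where
  Inst := DCCoverInstance
  encode := DCCoverInstance.encode
  size x := x.n
  param x := x.S.card
  Yes x := HasDefectiveColoring x.G x.χ x.Δ

/-! Let `S` be the set of ends of a maximal matching, with `k` vertices: it is a vertex cover, and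
`k ≤ 2κ` for the size `κ` of any other cover. If `χ > k`, the vertices of `S` get distinct colors
and the independent rest shares one more. If `χ ≥ 2` and `Δ ≥ k`, color `S` with one color and the
rest with another; monochromatic edges then stay inside `S`. There remain `χ ≤ k` with `Δ < k` or `χ
= 1`.

There a dynamic program adds the vertices one at a time, those of `S` first, so that the earlier
neighbours of a new vertex always lie in `S`. Hence all that matters about a partial coloring is its
code: the color and the current same-color degree of each vertex of `S`. This suffices to decide
whether a color is admissible and to compute the next code (`goodOn_insert_iff`, `code_insert`,
combined in `codes_insert`). A vertex outside `S` needs no record: its neighbours are all present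
when it arrives, and later vertices are not adjacent to it.

For `χ ≥ 2` there are at most `(χ(Δ+1)+1)^k ≤ (k+2)^(2k)` codes, and for `χ = 1` at most one. Lists
are kept free of repetitions by pairwise comparison, so the time is polynomial in this number and in
`n`, that is, `κ^O(κ) n^O(1)` (`search_time_le`, `solve_spec`). As the program finds its own cover,
it serves both claims; a known cover enters only the time bound. -/

namespace RAM

-- Reasoning about programs with step bounds

infixr:60 " ⨾ " => Prog.seq

theorem State.setReg_reg (s : State) (i v r : ℕ) :
    (s.setReg i v).reg r = if r = i then v else s.reg r := by
  simp [State.setReg, Function.update_apply]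

theorem State.setReg_mem (s : State) (i v : ℕ) : (s.setReg i v).mem = s.mem := rfl

theorem State.setMem_reg (s : State) (a v : ℕ) : (s.setMem a v).reg = s.reg := rfl

theorem State.setMem_mem (s : State) (a v b : ℕ) :
    (s.setMem a v).mem b = if b = a then v else s.mem b := by
  simp [State.setMem, Function.update_apply]

namespace Prog

/-- The registers a program may write to. -/
def writes : Prog → List ℕ
  | skip => []
  | const i _ => [i]
  | add i _ _ => [i]
  | sub i _ _ => [i]
  | load i _ => [i]
  | store _ _ => []
  | seq p q => p.writes ++ q.writes
  | branch _ p q => p.writes ++ q.writes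
  | loop _ p => p.writes

/-- Whether a program may write to memory. -/
def stores : Prog → Bool
  | store _ _ => true
  | seq p q => p.stores || q.stores
  | branch _ p q => p.stores || q.stores
  | loop _ p => p.stores
  | _ => false

/-- Whether a program has no loops. -/
def straight : Prog → Bool
  | seq p q => p.straight && q.straight
  | branch _ p q => p.straight && q.straight
  | loop _ _ => false
  | _ => true

/-- The final state of a program without loops. -/
def eval : Prog → State → State
  | skip, s => s
  | const i v, s => s.setReg i v
  | add i j k, s => s.setReg i (s.reg j + s.reg k)
  | sub i j k, s => s.setReg i (s.reg j - s.reg k)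
  | load i j, s => s.setReg i (s.mem (s.reg j))
  | store i j, s => s.setMem (s.reg i) (s.reg j)
  | seq p q, s => q.eval (p.eval s)
  | branch i p q, s => if s.reg i = 0 then q.eval s else p.eval s
  | loop _ _, s => s

/-- A bound for the number of steps of a program without loops. -/
def cost : Prog → ℕ
  | seq p q => p.cost + q.cost
  | branch _ p q => max p.cost q.cost + 1
  | _ => 1

/-- What a run from `s` to `s'` of a program leaves unchanged for syntactic reasons. -/
structure Frame (p : Prog) (s s' : State) : Prop where
  reg : ∀ r, r ∉ p.writes → s'.reg r = s.reg r
  mem : p.stores = false → s'.mem = s.mem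

theorem Frame.refl (p : Prog) (s : State) : p.Frame s s := ⟨fun _ _ => rfl, fun _ => rfl⟩

theorem Frame.trans {p : Prog} {s₁ s₂ s₃ : State} (h : p.Frame s₁ s₂) (h' : p.Frame s₂ s₃) :
    p.Frame s₁ s₃ :=
  ⟨fun r hr => (h'.reg r hr).trans (h.reg r hr), fun hp => (h'.mem hp).trans (h.mem hp)⟩

/-- This keeps loop invariants short: the registers a loop never writes are recovered by `decide`,
and only changing ones need to be mentioned. -/
theorem _root_.RAM.Exec.frame {p : Prog} {s s' : State} {t : ℕ} (h : Exec p s t s') :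
    p.Frame s s' := by
  induction h with
  | skip | const | add | sub | load | store | loop_zero =>
    constructor <;> simp +contextual [writes, stores, State.setReg, State.setMem]
  | seq _ _ ih₁ ih₂ =>
    constructor
    · intro r hr
      simp only [writes, List.mem_append, not_or] at hr
      rw [ih₂.reg r hr.2, ih₁.reg r hr.1]
    · intro h
      simp only [stores, Bool.or_eq_false_iff] at h
      rw [ih₂.mem h.2, ih₁.mem h.1]
  | branch_pos _ _ ih =>
    constructor
    · intro r hr
      simp only [writes, List.mem_append, not_or] at hr
      exact ih.reg r hr.1
    · intro h
      simp only [stores, Bool.or_eq_false_iff] at h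
      exact ih.mem h.1
  | branch_zero _ _ ih =>
    constructor
    · intro r hr
      simp only [writes, List.mem_append, not_or] at hr
      exact ih.reg r hr.2
    · intro h
      simp only [stores, Bool.or_eq_false_iff] at h
      exact ih.mem h.2
  | loop_pos _ _ _ ih₁ ih₂ =>
    constructor
    · intro r hr
      rw [ih₂.reg r hr, ih₁.reg r hr]
    · intro h
      rw [ih₂.mem h, ih₁.mem h]

/-- Started in `s`, the program `p` halts after at most `T` steps in a state satisfying `Q`. -/
def HaltsWithin (p : Prog) (s : State) (T : ℕ) (Q : State → Prop) : Prop :=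
  ∃ (t : ℕ) (s' : State), Exec p s t s' ∧ t ≤ T ∧ Q s'

theorem HaltsWithin.imp {p : Prog} {s : State} {T T' : ℕ} {Q Q' : State → Prop}
    (h : p.HaltsWithin s T Q) (hT : T ≤ T') (hQ : ∀ s', p.Frame s s' → Q s' → Q' s') :
    p.HaltsWithin s T' Q' :=
  let ⟨t, s', he, ht, hq⟩ := h
  ⟨t, s', he, ht.trans hT, hQ s' he.frame hq⟩

theorem HaltsWithin.seq {p q : Prog} {s : State} {T T₁ T₂ : ℕ} {Q R : State → Prop}
    (h : p.HaltsWithin s T₁ R)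
    (h' : ∀ s', p.Frame s s' → R s' → q.HaltsWithin s' T₂ Q) (hT : T₁ + T₂ ≤ T) :
    (p ⨾ q).HaltsWithin s T Q :=
  let ⟨t₁, s₁, he₁, ht₁, hr⟩ := h
  let ⟨t₂, s₂, he₂, ht₂, hq⟩ := h' s₁ he₁.frame hr
  ⟨t₁ + t₂, s₂, he₁.seq he₂, by omega, hq⟩

theorem HaltsWithin.branch {i : ℕ} {p q : Prog} {s : State} {T T' : ℕ} {Q : State → Prop}
    (hp : s.reg i ≠ 0 → p.HaltsWithin s T' Q) (hq : s.reg i = 0 → q.HaltsWithin s T' Q)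
    (hT : T' + 1 ≤ T) : (Prog.branch i p q).HaltsWithin s T Q := by
  by_cases h : s.reg i = 0
  · obtain ⟨t, s', he, ht, h'⟩ := hq h
    exact ⟨t + 1, s', .branch_zero h he, by omega, h'⟩
  · obtain ⟨t, s', he, ht, h'⟩ := hp h
    exact ⟨t + 1, s', .branch_pos h he, by omega, h'⟩

theorem exec_of_straight {p : Prog} (hp : p.straight = true) (s : State) :
    ∃ t ≤ p.cost, Exec p s t (p.eval s) := by
  induction p generalizing s with
  | skip => exact ⟨1, le_rfl, .skip s⟩
  | const i v => exact ⟨1, le_rfl, .const i v s⟩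
  | add i j k => exact ⟨1, le_rfl, .add i j k s⟩
  | sub i j k => exact ⟨1, le_rfl, .sub i j k s⟩
  | load i j => exact ⟨1, le_rfl, .load i j s⟩
  | store i j => exact ⟨1, le_rfl, .store i j s⟩
  | seq p q ihp ihq =>
    simp only [straight, Bool.and_eq_true] at hp
    obtain ⟨t, ht, h⟩ := ihp hp.1 s
    obtain ⟨t', ht', h'⟩ := ihq hp.2 (p.eval s)
    exact ⟨t + t', Nat.add_le_add ht ht', h.seq h'⟩
  | branch i p q ihp ihq =>
    simp only [straight, Bool.and_eq_true] at hp
    by_cases hi : s.reg i = 0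
    · obtain ⟨t, ht, h⟩ := ihq hp.2 s
      refine ⟨t + 1, ?_, ?_⟩
      · simp only [cost]; omega
      · simpa only [eval, if_pos hi] using Exec.branch_zero hi h
    · obtain ⟨t, ht, h⟩ := ihp hp.1 s
      refine ⟨t + 1, ?_, ?_⟩
      · simp only [cost]; omega
      · simpa only [eval, if_neg hi] using Exec.branch_pos hi h
  | loop => simp [straight] at hp

theorem HaltsWithin.of_eval {p : Prog} {s : State} {T : ℕ} {Q : State → Prop}
    (hp : p.straight = true) (hT : p.cost ≤ T) (hQ : Q (p.eval s)) : p.HaltsWithin s T Q :=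
  let ⟨t, ht, h⟩ := exec_of_straight hp s
  ⟨t, p.eval s, h, ht.trans hT, hQ⟩

/-- A straight-line program followed by another program. -/
theorem HaltsWithin.eval_seq {p q : Prog} {s : State} {T T₂ : ℕ} {Q : State → Prop}
    (hp : p.straight = true) (h' : q.HaltsWithin (p.eval s) T₂ Q) (hT : p.cost + T₂ ≤ T) :
    (p ⨾ q).HaltsWithin s T Q :=
  (HaltsWithin.of_eval (Q := fun s' => s' = p.eval s) hp le_rfl rfl).seq
    (fun _ _ h => h ▸ h') hT

/-- The rule for loops that count register `c` down from `N`. -/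
theorem HaltsWithin.loop {c : ℕ} {p : Prog} {s : State} {N T T' : ℕ} (I : ℕ → State → Prop)
    (hc : s.reg c = N) (h0 : I 0 s)
    (hstep : ∀ i < N, ∀ s', I i s' → s'.reg c = N - i → p.Frame s s' →
      p.HaltsWithin s' T fun s'' => I (i + 1) s'' ∧ s''.reg c = N - (i + 1))
    (hT : N * (T + 1) + 1 ≤ T') :
    (Prog.loop c p).HaltsWithin s T' fun s' => I N s' ∧ s'.reg c = 0 := by
  -- Generalized to a run entered with `m` rounds left. A round costs `T` and one test; the final
  -- failing test is the `+ 1`.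
  suffices H : ∀ m i s', i + m = N → I i s' → s'.reg c = N - i → p.Frame s s' →
      (Prog.loop c p).HaltsWithin s' (m * (T + 1) + 1) fun s' => I N s' ∧ s'.reg c = 0 from
    (H N 0 s (by omega) h0 (by omega) (.refl _ _)).imp hT fun _ _ h => h
  intro m
  induction m with
  | zero =>
    intro i s' hi hI hr _
    obtain rfl : i = N := by omega
    exact ⟨1, s', .loop_zero (by omega), by omega, hI, by omega⟩
  | succ m ih =>
    intro i s' hi hI hr hf
    obtain ⟨t₁, s₁, he₁, ht₁, hI₁, hr₁⟩ := hstep i (by omega) s' hI hr hf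
    obtain ⟨t₂, s₂, he₂, ht₂, hQ⟩ := ih (i + 1) s₁ (by omega) hI₁ hr₁ (hf.trans he₁.frame)
    refine ⟨t₁ + t₂ + 1, s₂, .loop_pos (by omega) he₁ he₂, ?_, hQ⟩
    have : (m + 1) * (T + 1) = m * (T + 1) + (T + 1) := by ring
    omega

end Prog

end RAM

namespace RAM

namespace DefectiveColoring

open Prog

/-! ### The program

The program `solve` below computes a vertex cover `S` of `k` vertices, at most twice the minimum,
from a maximal matching. If `k < χ`, or if `2 ≤ χ` and `k ≤ Δ`, there is a coloring. Otherwise it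
adds the vertices one by one, those of `S` first, and keeps a list without repetitions of the codes
of all defective colorings of the vertices added so far. A code is a block of `n` cells that holds
for each vertex of `S` its color and the number of its neighbours of the same color.

The memory holds the adjacency matrix, the marks of `S`, and then the blocks. Registers:
* 0, 1, 2: the input `n`, `χ`, `Δ`; 3: the constant `1`; 4: the address `n * n` of the marks;
  6: the number `k`; 9: the constant `0`;
* 11, 12: addresses of the adjacency row and of the mark of the new vertex; 15: the mark of the
  vertices to be added in the current pass;
* 16: address of the block to be extended; 18: start of the new list; 21: start of the code window
  of the color that is tried;
* 60, 61: start and length of the current list; 62: address of the first free cell; 63: length of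
  the new list;
* the others are counters, running addresses and intermediate results. -/

/-! ### Lists of memory blocks without repetitions -/

/-- One step of the comparison of two blocks. -/
def compareStep : Prog :=
  load 46 41 ⨾ load 47 44 ⨾ sub 48 46 47 ⨾ sub 49 47 46 ⨾ add 45 45 48 ⨾ add 45 45 49 ⨾
    add 41 41 3 ⨾ add 44 44 3 ⨾ sub 43 43 3

/-- Compare the blocks of length `reg 0` at `reg 41` and `reg 62`: `reg 45` becomes `0` if they
agree, and `reg 41` moves to the next block. -/
def compare : Prog :=
  (add 43 0 9 ⨾ add 44 62 9 ⨾ const 45 0) ⨾ loop 43 compareStep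

/-- The truncated differences in both orders add up to the absolute difference, so the accumulator
vanishes exactly if all cells agree. -/
theorem compare_spec (s : State) (h3 : s.reg 3 = 1) (h9 : s.reg 9 = 0) :
    compare.HaltsWithin s (10 * s.reg 0 + 4) fun s' => s'.reg 41 = s.reg 41 + s.reg 0 ∧
      (s'.reg 45 = 0 ↔ ∀ u < s.reg 0, s.mem (s.reg 41 + u) = s.mem (s.reg 62 + u)) := by
  refine HaltsWithin.eval_seq rfl (T₂ := 10 * s.reg 0 + 1) ?_ (by simp [cost]; omega)
  refine (HaltsWithin.loop (N := s.reg 0) (T := 9)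
    (fun i s' => s'.reg 41 = s.reg 41 + i ∧ s'.reg 44 = s.reg 62 + i ∧
      (s'.reg 45 = 0 ↔ ∀ u < i, s.mem (s.reg 41 + u) = s.mem (s.reg 62 + u)))
    ?_ ?_ ?_ (by omega)).imp le_rfl ?_
  · simp [eval, State.setReg_reg, h9]
  · simp [eval, State.setReg_reg, h9]
  · rintro i hi s' ⟨h41, h44, h45⟩ h43 hf
    have h3' : s'.reg 3 = 1 := by rw [hf.reg 3 (by decide)]; simp [eval, State.setReg_reg, h3]
    have hm : s'.mem = s.mem := hf.mem rfl
    refine .of_eval rfl le_rfl ?_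
    simp only [compareStep, eval, State.setReg_reg, State.setReg_mem, hm, h41, h44, h43, h3']
    simp only [Nat.forall_lt_succ_right, ← h45]
    simp
    omega
  · rintro s' hf ⟨⟨h1, h2, h3⟩, _⟩
    exact ⟨h1, h3⟩

/-- The block of `n` memory cells starting at address `a`. -/
def block (n : ℕ) (mem : ℕ → ℕ) (a : ℕ) : Fin n → ℕ := fun u => mem (a + u)

theorem block_congr {n : ℕ} {mem mem' : ℕ → ℕ} {a b : ℕ} (h : ∀ c < b, mem' c = mem c)
    (hab : a + n ≤ b) : block n mem' a = block n mem a :=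
  funext fun u => h _ (by omega)

/-- The `k` consecutive blocks starting at address `a` list the set `A` without repetitions. -/
structure Lists {n : ℕ} (mem : ℕ → ℕ) (a k : ℕ) (A : Set (Fin n → ℕ)) : Prop where
  inj : ∀ i < k, ∀ j < k, block n mem (a + i * n) = block n mem (a + j * n) → i = j
  mem_iff : ∀ f, f ∈ A ↔ ∃ i < k, block n mem (a + i * n) = f

theorem Lists.zero {n : ℕ} (mem : ℕ → ℕ) (a : ℕ) : Lists mem a 0 (∅ : Set (Fin n → ℕ)) :=
  ⟨by simp, by simp⟩

theorem Lists.congr {n : ℕ} {mem mem' : ℕ → ℕ} {a k b : ℕ} {A : Set (Fin n → ℕ)}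
    (h : Lists mem a k A) (hm : ∀ c < b, mem' c = mem c) (hab : a + k * n ≤ b) :
    Lists mem' a k A := by
  have H : ∀ i < k, block n mem' (a + i * n) = block n mem (a + i * n) := fun i hi =>
    block_congr hm (by have := Nat.mul_le_mul_right n (Nat.succ_le_of_lt hi); grind)
  refine ⟨fun i hi j hj hij => h.inj i hi j hj (by rwa [← H i hi, ← H j hj]), fun f => ?_⟩
  rw [h.mem_iff]
  exact exists_congr fun i => and_congr_right fun hi => by rw [H i hi]

/-- The absence of repetitions turns a bound on the number of codes into a bound on the list length,
hence on the running time. -/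
theorem Lists.length_le {n : ℕ} {mem : ℕ → ℕ} {a k L : ℕ} {A B : Set (Fin n → ℕ)}
    (h : Lists mem a k A) (hAB : A ⊆ B) (hB : B.Finite) (hL : B.ncard ≤ L) : k ≤ L := by
  have := Set.ncard_le_ncard_of_injOn (s := (Finset.range k : Set ℕ)) (t := B)
    (fun i => block n mem (a + i * n))
    (fun i hi => hAB ((h.mem_iff _).2 ⟨i, by simpa using hi, rfl⟩))
    (fun i hi j hj hij => h.inj i (by simpa using hi) j (by simpa using hj) hij) hB
  rw [Set.ncard_coe_finset, Finset.card_range] at this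
  omega

theorem Lists.append {n : ℕ} {mem : ℕ → ℕ} {a k : ℕ} {A : Set (Fin n → ℕ)}
    (h : Lists mem a k A) (hA : block n mem (a + k * n) ∉ A) :
    Lists mem a (k + 1) (insert (block n mem (a + k * n)) A) := by
  have hne : ∀ i < k, block n mem (a + i * n) ≠ block n mem (a + k * n) :=
    fun i hi hik => hA ((h.mem_iff _).2 ⟨i, hi, hik⟩)
  constructor
  · intro i hi j hj hij
    rcases Nat.lt_succ_iff_lt_or_eq.1 hi with hi | rfl <;>
      rcases Nat.lt_succ_iff_lt_or_eq.1 hj with hj | rfl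
    · exact h.inj i hi j hj hij
    · exact absurd hij (hne i hi)
    · exact absurd hij.symm (hne j hj)
    · rfl
  · intro f
    rw [Set.mem_insert_iff, h.mem_iff, Nat.exists_lt_succ_right, or_comm, @eq_comm _ f]

/-- Search the blocks listed from `reg 18` on for the block at `reg 62`. -/
def searchStep : Prog :=
  compare ⨾ branch 45 skip (const 42 1) ⨾ sub 40 40 3

/-- Append the block at `reg 62` to the list of `reg 63` blocks starting at `reg 18`, unless it is
listed already. -/
def appendNew : Prog :=
  (add 40 63 9 ⨾ add 41 18 9 ⨾ const 42 0) ⨾ loop 40 searchStep ⨾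
    branch 42 skip (add 62 62 0 ⨾ add 63 63 3)

/-- The candidate already sits directly behind the list, so appending only advances the end pointer;
a duplicate is left outside the list. -/
theorem appendNew_spec {n : ℕ} {A : Set (Fin n → ℕ)} (s : State) (h0 : s.reg 0 = n)
    (h3 : s.reg 3 = 1) (h9 : s.reg 9 = 0) (hA : Lists s.mem (s.reg 18) (s.reg 63) A)
    (h62 : s.reg 62 = s.reg 18 + s.reg 63 * n) {L : ℕ} (hL : s.reg 63 ≤ L) :
    appendNew.HaltsWithin s (L * (10 * n + 8) + 7) fun s' =>
      Lists s.mem (s.reg 18) (s'.reg 63) (insert (block n s.mem (s.reg 62)) A) ∧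
      s'.reg 62 = s.reg 18 + s'.reg 63 * n ∧ s.reg 63 ≤ s'.reg 63 := by
  set f := block n s.mem (s.reg 62) with hf
  have hT := Nat.mul_le_mul_right (10 * n + 8) hL
  refine HaltsWithin.eval_seq rfl (T₂ := s.reg 63 * (10 * n + 8) + 4) ?_ (by simp [cost]; omega)
  refine HaltsWithin.seq (HaltsWithin.loop (N := s.reg 63) (T := 10 * n + 7)
    (T' := s.reg 63 * (10 * n + 8) + 1)
    (fun i s' => s'.reg 41 = s.reg 18 + i * n ∧
      (s'.reg 42 = 0 ↔ ∀ j < i, block n s.mem (s.reg 18 + j * n) ≠ f))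
    ?_ ?_ ?_ le_rfl) (T₂ := 3) ?_ (by omega)
  · simp [eval, State.setReg_reg, h9]
  · simp [eval, State.setReg_reg, h9]
  · rintro i hi s' ⟨h41, h42⟩ h40 hfr
    have h3' : s'.reg 3 = 1 := by rw [hfr.reg 3 (by decide)]; simp [eval, State.setReg_reg, h3]
    have h9' : s'.reg 9 = 0 := by rw [hfr.reg 9 (by decide)]; simp [eval, State.setReg_reg, h9]
    have h0' : s'.reg 0 = n := by rw [hfr.reg 0 (by decide)]; simp [eval, State.setReg_reg, h0]
    have h62' : s'.reg 62 = s.reg 62 := by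
      rw [hfr.reg 62 (by decide)]; simp [eval, State.setReg_reg]
    have hm : s'.mem = s.mem := hfr.mem rfl
    refine (compare_spec s' h3' h9').seq (T₂ := 3) ?_ (by omega)
    rintro s'' hfr' ⟨h41', h45⟩
    have h45' : s''.reg 45 = 0 ↔ block n s.mem (s.reg 18 + i * n) = f := by
      rw [h45, funext_iff, Fin.forall_iff]
      simp only [h0', hm, h41, h62', block, hf]
    refine .of_eval rfl le_rfl ?_
    have a40 := hfr'.reg 40 (by decide)
    have a42 := hfr'.reg 42 (by decide)
    have a3 := hfr'.reg 3 (by decide)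
    simp only [Nat.forall_lt_succ_right]
    by_cases hc : s''.reg 45 = 0
    · have := h45'.1 hc
      simp [eval, State.setReg_reg, hc, a40, a3, h40, h3', this, h41', h41, h0']
      grind
    · have := mt h45'.2 hc
      simp [eval, State.setReg_reg, hc, a40, a3, h40, h3', a42, h42, this, h41', h41, h0']
      grind
  · rintro s' hfr ⟨⟨-, h42⟩, -⟩
    refine .of_eval rfl le_rfl ?_
    have a3 : s'.reg 3 = 1 := by rw [hfr.reg 3 (by decide)]; simp [eval, State.setReg_reg, h3]
    have a0 : s'.reg 0 = n := by rw [hfr.reg 0 (by decide)]; simp [eval, State.setReg_reg, h0]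
    have a62 : s'.reg 62 = s.reg 62 := by
      rw [hfr.reg 62 (by decide)]; simp [eval, State.setReg_reg]
    have a63 : s'.reg 63 = s.reg 63 := by
      rw [hfr.reg 63 (by decide)]; simp [eval, State.setReg_reg]
    have hfA : s'.reg 42 = 0 ↔ f ∉ A := by
      rw [h42, hA.mem_iff]; simp
    by_cases hc : s'.reg 42 = 0
    · simp only [eval, State.setReg_reg, hc, a3, a0, a62, a63, if_true]
      refine ⟨?_, ?_, ?_⟩
      · have := hfA.1 hc
        rw [hf, h62] at this ⊢
        exact hA.append this
      · simp; grind
      · simp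
    · simp only [eval, hc, if_false, a62, a63]
      rw [Set.insert_eq_of_mem (by simpa using mt hfA.2 hc)]
      exact ⟨hA, h62, le_rfl⟩

/-! ### Extending one code by one colored vertex -/

/-- Vertex `u` is a neighbour whose code says that it has the color with code window
`(b, b + Δ + 1]`. -/
def Hit {n : ℕ} (adj : Fin n → Prop) (b Δ : ℕ) (f : Fin n → ℕ) (u : Fin n) : Prop :=
  adj u ∧ b < f u ∧ f u ≤ b + Δ + 1

open Classical in
/-- The number of neighbours that have the color with code window `(b, b + Δ + 1]`. -/
noncomputable def hits {n : ℕ} (adj : Fin n → Prop) (b Δ : ℕ) (f : Fin n → ℕ) : ℕ :=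
  (Finset.univ.filter (Hit adj b Δ f)).card

/-- The color with code window `(b, b + Δ + 1]` may be given to a new vertex with neighbourhood
`adj`. -/
def Extendable {n : ℕ} (adj : Fin n → Prop) (b Δ : ℕ) (f : Fin n → ℕ) : Prop :=
  hits adj b Δ f ≤ Δ ∧ ∀ u, Hit adj b Δ f u → f u ≠ b + Δ + 1

open Classical in
/-- The code after the new vertex `v` has received the color with code window `(b, b + Δ + 1]`;
the code of `v` itself is recorded only if `inS` holds. -/
noncomputable def extend {n : ℕ} (adj : Fin n → Prop) (inS : Prop) (v : Fin n) (b Δ : ℕ)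
    (f : Fin n → ℕ) : Fin n → ℕ := fun u =>
  if u = v ∧ inS then b + 1 + hits adj b Δ f else if Hit adj b Δ f u then f u + 1 else f u

open Classical in
-- Links the cardinality over `Fin n` in `hits` to the count over `ℕ` that a loop accumulates.
theorem card_filter_fin_eq_count {n : ℕ} (P : Fin n → Prop) (Q : ℕ → Prop)
    (h : ∀ u : Fin n, P u ↔ Q u) : (Finset.univ.filter P).card = Nat.count Q n := by
  rw [Nat.count_eq_card_filter_range, Finset.card_filter, Finset.card_filter, Finset.sum_range]
  exact Finset.sum_congr rfl fun u _ => by simp only [h]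

/-- Read the code of a vertex, adapt it to the new color, count the hits in `reg 29` and report
overflows in `reg 30`. -/
def tryRead : Prog :=
  (load 32 26 ⨾ load 33 28 ⨾ sub 34 32 21 ⨾ sub 36 32 31 ⨾ sub 35 31 32) ⨾
  branch 33 (branch 34 (branch 36 skip
    (add 32 32 3 ⨾ add 29 29 3 ⨾ branch 35 skip (const 30 1))) skip) skip

/-- Write the new code of a vertex and move on to the next one. -/
def tryWrite : Prog :=
  store 27 32 ⨾ add 26 26 3 ⨾ add 27 27 3 ⨾ add 28 28 3 ⨾ sub 25 25 3

open Classical in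
-- The nested branches test the three conjuncts of `H`. The innermost one detects a code at the top
-- of the window `reg 31`: a neighbour that already has defect `Δ` and cannot gain another.
theorem tryRead_spec (s : State) (h3 : s.reg 3 = 1) (H : Prop)
    (hH : H ↔ s.mem (s.reg 28) ≠ 0 ∧ s.reg 21 < s.mem (s.reg 26) ∧
      s.mem (s.reg 26) ≤ s.reg 31) :
    tryRead.HaltsWithin s 12 fun s' =>
      s'.reg 32 = (if H then s.mem (s.reg 26) + 1 else s.mem (s.reg 26)) ∧
      s'.reg 29 = s.reg 29 + (if H then 1 else 0) ∧
      (s'.reg 30 = 0 ↔ s.reg 30 = 0 ∧ (H → s.mem (s.reg 26) ≠ s.reg 31)) := by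
  refine .of_eval rfl (by decide) ?_
  by_cases c1 : s.mem (s.reg 28) = 0
  · have hH' : ¬ H := by tauto
    simp [tryRead, eval, State.setReg_reg, State.setReg_mem, c1, hH']
  by_cases c2 : s.mem (s.reg 26) - s.reg 21 = 0
  · have hH' : ¬ H := by rw [hH]; omega
    simp [tryRead, eval, State.setReg_reg, State.setReg_mem, c1, c2, hH']
  by_cases c3 : s.mem (s.reg 26) - s.reg 31 = 0
  · have hH' : H := by rw [hH]; omega
    by_cases c4 : s.reg 31 - s.mem (s.reg 26) = 0
    · have : s.mem (s.reg 26) = s.reg 31 := by omega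
      simp [tryRead, eval, State.setReg_reg, State.setReg_mem, c1, hH', h3, this]
      simp [this ▸ c2, State.setReg_reg]
    · have : s.mem (s.reg 26) ≠ s.reg 31 := by omega
      simp [tryRead, eval, State.setReg_reg, State.setReg_mem, c1, c2, c3, c4, hH', h3]
      exact fun _ => this
  · have hH' : ¬ H := by rw [hH]; omega
    simp [tryRead, eval, State.setReg_reg, State.setReg_mem, c1, c2, c3, hH']

/-- Write the extension of the block at `reg 16` to the block at `reg 62`. -/
def tryLoop : Prog :=
  (add 25 0 9 ⨾ add 26 16 9 ⨾ add 27 62 9 ⨾ add 28 11 9 ⨾ const 29 0 ⨾ const 30 0 ⨾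
    add 31 21 2 ⨾ add 31 31 3) ⨾ loop 25 (tryRead ⨾ tryWrite)

open Classical in
theorem tryLoop_spec (s : State) (h3 : s.reg 3 = 1) (h9 : s.reg 9 = 0)
    (h16 : s.reg 16 + s.reg 0 ≤ s.reg 62) (h11 : s.reg 11 + s.reg 0 ≤ s.reg 62)
    (H : ℕ → Prop) (hH : ∀ u, H u ↔ s.mem (s.reg 11 + u) ≠ 0 ∧ s.reg 21 < s.mem (s.reg 16 + u) ∧
      s.mem (s.reg 16 + u) ≤ s.reg 21 + s.reg 2 + 1) :
    tryLoop.HaltsWithin s (20 * s.reg 0 + 9) fun s' =>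
      s'.reg 29 = Nat.count H (s.reg 0) ∧
      (s'.reg 30 = 0 ↔
        ∀ u < s.reg 0, H u → s.mem (s.reg 16 + u) ≠ s.reg 21 + s.reg 2 + 1) ∧
      (∀ a < s.reg 62, s'.mem a = s.mem a) ∧
      ∀ u < s.reg 0, s'.mem (s.reg 62 + u) =
        if H u then s.mem (s.reg 16 + u) + 1 else s.mem (s.reg 16 + u) := by
  refine HaltsWithin.eval_seq rfl (T₂ := 20 * s.reg 0 + 1) ?_ (by simp [cost]; omega)
  refine (HaltsWithin.loop (N := s.reg 0) (T := 19)
    (fun i s' => s'.reg 26 = s.reg 16 + i ∧ s'.reg 27 = s.reg 62 + i ∧ s'.reg 28 = s.reg 11 + i ∧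
      s'.reg 29 = Nat.count H i ∧
      (s'.reg 30 = 0 ↔ ∀ u < i, H u → s.mem (s.reg 16 + u) ≠ s.reg 21 + s.reg 2 + 1) ∧
      (∀ a < s.reg 62, s'.mem a = s.mem a) ∧
      ∀ u < i, s'.mem (s.reg 62 + u) =
        if H u then s.mem (s.reg 16 + u) + 1 else s.mem (s.reg 16 + u))
    ?_ ?_ ?_ (by omega)).imp le_rfl ?_
  · simp [eval, State.setReg_reg, h9]
  · simp [eval, State.setReg_reg, State.setReg_mem, h9]
  · rintro i hi s' ⟨h26, h27, h28, h29, h30, hlow, hup⟩ h25 hf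
    have a3 : s'.reg 3 = 1 := by rw [hf.reg 3 (by decide)]; simp [eval, State.setReg_reg, h3]
    have a21 : s'.reg 21 = s.reg 21 := by
      rw [hf.reg 21 (by decide)]; simp [eval, State.setReg_reg]
    have a31 : s'.reg 31 = s.reg 21 + s.reg 2 + 1 := by
      rw [hf.reg 31 (by decide)]; simp [eval, State.setReg_reg, h3]
    -- The source block and the adjacency row lie below the target block, so earlier writes have not
    -- touched them.
    have m1 : s'.mem (s.reg 16 + i) = s.mem (s.reg 16 + i) := hlow _ (by omega)
    have m2 : s'.mem (s.reg 11 + i) = s.mem (s.reg 11 + i) := hlow _ (by omega)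
    simp only [Nat.forall_lt_succ_right, ← h30, Nat.count_succ]
    refine (tryRead_spec s' a3 (H i) (by rw [hH, h28, h26, m1, m2, a21, a31])).seq (T₂ := 5) ?_
      (by omega)
    rintro s'' hf' ⟨e32, e29, e30⟩
    rw [h26, m1] at e32
    rw [h29] at e29
    rw [h26, m1, a31] at e30
    have e26 := (hf'.reg 26 (by decide)).trans h26
    have e27 := (hf'.reg 27 (by decide)).trans h27
    have e28 := (hf'.reg 28 (by decide)).trans h28
    have e25 := (hf'.reg 25 (by decide)).trans h25
    have e3 := (hf'.reg 3 (by decide)).trans a3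
    have em := hf'.mem rfl
    refine .of_eval rfl (by decide) ?_
    simp only [tryWrite, eval, State.setReg_reg, State.setMem_reg, State.setReg_mem,
      State.setMem_mem, e26, e27, e28, e25, e3, e32, e29, em]
    simp
    refine ⟨⟨by omega, by omega, by omega, e30, fun a ha => ?_, fun u hu => ?_⟩, by omega⟩
    · rw [if_neg (by omega), hlow a ha]
    · rw [if_neg (by omega), hup u hu]
  · rintro s' hf ⟨⟨h1, h2, h3, h4⟩, _⟩
    tauto

/-- Record the code of the new vertex if its mark at `reg 12` is set, and report in `reg 30` whether
it has too many hits. -/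
def tryMark : Prog :=
  (load 33 12 ⨾ sub 34 12 4 ⨾ add 34 34 62 ⨾ add 35 21 3 ⨾ add 35 35 29) ⨾
  branch 33 (store 34 35) skip ⨾ sub 33 29 2 ⨾ add 30 30 33

open Classical in
-- The index of the new vertex is the distance of its mark from the start of the marks at `reg 4`.
theorem tryMark_spec (s : State) (h3 : s.reg 3 = 1) {v : ℕ} (hv : s.reg 12 = s.reg 4 + v)
    {M : Prop} (hM : M ↔ s.mem (s.reg 12) ≠ 0) :
    tryMark.HaltsWithin s 9 fun s' =>
      (s'.reg 30 = 0 ↔ s.reg 30 = 0 ∧ s.reg 29 ≤ s.reg 2) ∧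
      ∀ a, s'.mem a = if a = s.reg 62 + v ∧ M
        then s.reg 21 + 1 + s.reg 29 else s.mem a := by
  refine .of_eval rfl (by decide) ?_
  rw [hv] at hM
  by_cases c : s.mem (s.reg 4 + v) = 0
  · have hM' : ¬ M := by tauto
    simp [tryMark, eval, State.setReg_reg, State.setReg_mem, c, hv, hM']
    omega
  · have hM' : M := by tauto
    simp [tryMark, eval, State.setReg_reg, State.setReg_mem, State.setMem_mem, State.setMem_reg, c,
      h3, hv, hM', Nat.add_comm v]
    omega

/-- Extend the block at `reg 16` by the new vertex with color window starting at `reg 21`, and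
append the result to the new list. -/
def tryColor : Prog :=
  tryLoop ⨾ tryMark ⨾ branch 30 skip appendNew

theorem tryColor_spec {n : ℕ} {A : Set (Fin n → ℕ)} {adj : Fin n → Prop} {inS : Prop} {v : Fin n}
    (s : State) (h0 : s.reg 0 = n) (h3 : s.reg 3 = 1) (h9 : s.reg 9 = 0)
    (hv : s.reg 12 = s.reg 4 + v) (h12 : s.reg 12 < s.reg 62)
    (h16 : s.reg 16 + n ≤ s.reg 62) (h11 : s.reg 11 + n ≤ s.reg 62)
    (hadj : ∀ u : Fin n, adj u ↔ s.mem (s.reg 11 + u) ≠ 0) (hS : inS ↔ s.mem (s.reg 12) ≠ 0)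
    (hA : Lists s.mem (s.reg 18) (s.reg 63) A)
    (h62 : s.reg 62 = s.reg 18 + s.reg 63 * n) {L : ℕ} (hL : s.reg 63 ≤ L) :
    tryColor.HaltsWithin s ((L + 2) * (10 * n + 8) + 20) fun s' =>
      Lists s'.mem (s.reg 18) (s'.reg 63)
        (A ∪ {g | Extendable adj (s.reg 21) (s.reg 2) (block n s.mem (s.reg 16)) ∧
          g = extend adj inS v (s.reg 21) (s.reg 2) (block n s.mem (s.reg 16))}) ∧
      s'.reg 62 = s.reg 18 + s'.reg 63 * n ∧ s.reg 62 ≤ s'.reg 62 ∧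
      ∀ a < s.reg 62, s'.mem a = s.mem a := by
  classical
  set f := block n s.mem (s.reg 16) with hf
  obtain ⟨H, hH₀⟩ : ∃ H : ℕ → Prop, ∀ u, H u ↔ s.mem (s.reg 11 + u) ≠ 0 ∧
      s.reg 21 < s.mem (s.reg 16 + u) ∧ s.mem (s.reg 16 + u) ≤ s.reg 21 + s.reg 2 + 1 :=
    ⟨_, fun _ => Iff.rfl⟩
  have hH : ∀ u : Fin n, Hit adj (s.reg 21) (s.reg 2) f u ↔ H u := fun u => by
    simp only [Hit, hadj, hH₀, hf, block]
  have hcount : hits adj (s.reg 21) (s.reg 2) f = Nat.count H n :=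
    card_filter_fin_eq_count _ _ hH
  refine (tryLoop_spec s h3 h9 (h0 ▸ h16) (h0 ▸ h11) H hH₀).seq
    (T₂ := L * (10 * n + 8) + 17) ?_ (by rw [h0]; grind)
  rintro s₁ hf₁ ⟨r29, r30, m1, m2⟩
  have e62 := hf₁.reg 62 (by decide)
  have e12 := hf₁.reg 12 (by decide)
  have e21 := hf₁.reg 21 (by decide)
  have e2 := hf₁.reg 2 (by decide)
  refine (tryMark_spec s₁ ((hf₁.reg 3 (by decide)).trans h3) (v := v)
    (by rw [e12, hv, hf₁.reg 4 (by decide)]) (M := inS) (by rw [e12, m1 _ h12, hS])).seq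
    (T₂ := L * (10 * n + 8) + 8) ?_ (by omega)
  rintro s₂ hf₂ ⟨q30, m3⟩
  have e62' := (hf₂.reg 62 (by decide)).trans e62
  have e63' := (hf₂.reg 63 (by decide)).trans (hf₁.reg 63 (by decide))
  have e18' := (hf₂.reg 18 (by decide)).trans (hf₁.reg 18 (by decide))
  rw [e62, e21, r29, h0, ← hcount] at m3
  rw [r30, r29, h0, e2, ← hcount] at q30
  have hlow : ∀ a < s.reg 62, s₂.mem a = s.mem a := fun a ha => by
    rw [m3, if_neg (by omega), m1 a ha]
  have hext : s₂.reg 30 = 0 ↔ Extendable adj (s.reg 21) (s.reg 2) f := by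
    rw [q30, Extendable, and_comm, Fin.forall_iff]
    refine and_congr_right fun _ => forall₂_congr fun u hu => ?_
    rw [← hH ⟨u, hu⟩]
    rfl
  have hblock : block n s₂.mem (s.reg 62) = extend adj inS v (s.reg 21) (s.reg 2) f := by
    funext u
    simp only [block, m3, extend, hH]
    rw [m2 u (by omega)]
    have : s.reg 62 + (u : ℕ) = s.reg 62 + v ↔ u = v := by
      rw [Nat.add_left_cancel_iff, Fin.ext_iff]
    simp only [this]
    rfl
  -- The candidate was written behind the listed blocks. If it is rejected, the end pointer stays
  -- and the next candidate overwrites it.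
  have hA' : Lists s₂.mem (s.reg 18) (s.reg 63) A := hA.congr hlow h62.ge
  refine .branch (T' := L * (10 * n + 8) + 7) (fun hne => ?_) (fun he => ?_) le_rfl
  · refine .of_eval rfl (by simp [cost]) ?_
    have hE := mt hext.2 hne
    simp only [eval, hE, false_and, Set.ofPred_false, Set.union_empty, e63', e62']
    exact ⟨hA', h62, le_rfl, hlow⟩
  · have hE := hext.1 he
    refine (appendNew_spec s₂ (n := n) (A := A) (L := L)
      ((hf₂.reg 0 (by decide)).trans ((hf₁.reg 0 (by decide)).trans h0))
      ((hf₂.reg 3 (by decide)).trans ((hf₁.reg 3 (by decide)).trans h3))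
      ((hf₂.reg 9 (by decide)).trans ((hf₁.reg 9 (by decide)).trans h9))
      (by rwa [e18', e63']) (by rw [e62', e18', e63', h62]) (by rwa [e63'])).imp le_rfl ?_
    rintro s₃ hf₃ ⟨hl, h62', hle⟩
    rw [e18', e62', hblock] at hl
    rw [e18'] at h62'
    have hm := hf₃.mem rfl
    refine ⟨?_, h62', ?_, fun a ha => by rw [hm, hlow a ha]⟩
    · rw [hm]
      convert hl using 1
      ext g
      simp [hE]
    · rw [e63'] at hle
      rw [h62', h62]
      have := Nat.mul_le_mul_right n hle
      omega

/-! ### Extending a whole list of codes -/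

/-- The codes that arise from the code `f` when the new vertex `v` receives one of `χ` colors. -/
def nexts {n : ℕ} (adj : Fin n → Prop) (inS : Prop) (v : Fin n) (χ Δ : ℕ) (f : Fin n → ℕ) :
    Set (Fin n → ℕ) :=
  {g | ∃ j < χ, Extendable adj (j * (Δ + 1)) Δ f ∧ g = extend adj inS v (j * (Δ + 1)) Δ f}

theorem nexts_zero {n : ℕ} (adj : Fin n → Prop) (inS : Prop) (v : Fin n) (Δ : ℕ)
    (f : Fin n → ℕ) : nexts adj inS v 0 Δ f = ∅ := by
  simp [nexts]

theorem nexts_succ {n : ℕ} (adj : Fin n → Prop) (inS : Prop) (v : Fin n) (χ Δ : ℕ)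
    (f : Fin n → ℕ) : nexts adj inS v (χ + 1) Δ f = nexts adj inS v χ Δ f ∪
      {g | Extendable adj (χ * (Δ + 1)) Δ f ∧ g = extend adj inS v (χ * (Δ + 1)) Δ f} := by
  ext g
  simp only [nexts, Set.mem_union, Set.mem_ofPred_eq, Nat.exists_lt_succ_right]

theorem nexts_mono {n : ℕ} (adj : Fin n → Prop) (inS : Prop) (v : Fin n) {χ χ' : ℕ} (Δ : ℕ)
    (f : Fin n → ℕ) (h : χ ≤ χ') : nexts adj inS v χ Δ f ⊆ nexts adj inS v χ' Δ f :=
  fun _ ⟨j, hj, hg⟩ => ⟨j, hj.trans_le h, hg⟩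

/-- Try all colors for the new vertex in the block at `reg 16`. -/
def tryColors : Prog :=
  (add 20 1 9 ⨾ const 21 0) ⨾
  loop 20 (tryColor ⨾ add 21 21 2 ⨾ add 21 21 3 ⨾ sub 20 20 3)

/-- `B` contains every intermediate list, so each search inspects at most `L` blocks. The address
`b` separates the protected input (matrix row, mark, source block) from the growing list. -/
theorem tryColors_spec {n : ℕ} {A B : Set (Fin n → ℕ)} {adj : Fin n → Prop} {inS : Prop}
    {v : Fin n} (s : State) (h0 : s.reg 0 = n) (h3 : s.reg 3 = 1) (h9 : s.reg 9 = 0)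
    (hv : s.reg 12 = s.reg 4 + v) {b : ℕ} (hb : b ≤ s.reg 62) (h12 : s.reg 12 < b)
    (h16 : s.reg 16 + n ≤ b) (h11 : s.reg 11 + n ≤ b)
    (hadj : ∀ u : Fin n, adj u ↔ s.mem (s.reg 11 + u) ≠ 0) (hS : inS ↔ s.mem (s.reg 12) ≠ 0)
    (hA : Lists s.mem (s.reg 18) (s.reg 63) A)
    (h62 : s.reg 62 = s.reg 18 + s.reg 63 * n)
    (hAB : A ∪ nexts adj inS v (s.reg 1) (s.reg 2) (block n s.mem (s.reg 16)) ⊆ B)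
    (hB : B.Finite) {L : ℕ} (hL : B.ncard ≤ L) :
    tryColors.HaltsWithin s (s.reg 1 * ((L + 2) * (10 * n + 8) + 24) + 3) fun s' =>
      Lists s'.mem (s.reg 18) (s'.reg 63)
        (A ∪ nexts adj inS v (s.reg 1) (s.reg 2) (block n s.mem (s.reg 16))) ∧
      s'.reg 62 = s.reg 18 + s'.reg 63 * n ∧ b ≤ s'.reg 62 ∧
      ∀ a < b, s'.mem a = s.mem a := by
  set f := block n s.mem (s.reg 16) with hf
  refine HaltsWithin.eval_seq rfl (T₂ := s.reg 1 * ((L + 2) * (10 * n + 8) + 24) + 1) ?_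
    (by simp [cost]; omega)
  refine (HaltsWithin.loop (N := s.reg 1) (T := (L + 2) * (10 * n + 8) + 23)
    (fun j s' => s'.reg 21 = j * (s.reg 2 + 1) ∧
      Lists s'.mem (s.reg 18) (s'.reg 63) (A ∪ nexts adj inS v j (s.reg 2) f) ∧
      s'.reg 62 = s.reg 18 + s'.reg 63 * n ∧ b ≤ s'.reg 62 ∧
      ∀ a < b, s'.mem a = s.mem a)
    ?_ ?_ ?_ le_rfl).imp le_rfl fun s' _ h => h.1.2
  · simp [eval, State.setReg_reg, h9]
  · simp only [nexts_zero, Set.union_empty]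
    simp only [eval, State.setReg_reg, State.setReg_mem]
    simp [hA, h62]
    omega
  · rintro j hj s' ⟨h21, hA', h62', hb', hlow⟩ h20 hfr
    have init : ∀ r, r ∉ [20, 21] → ((add 20 1 9 ⨾ const 21 0).eval s).reg r = s.reg r := by
      intro r hr
      simp only [List.mem_cons, List.not_mem_nil, or_false, not_or] at hr
      simp [eval, State.setReg_reg, hr]
    have a0 := (hfr.reg 0 (by decide)).trans (init 0 (by decide))
    have a2 := (hfr.reg 2 (by decide)).trans (init 2 (by decide))
    have a3 := (hfr.reg 3 (by decide)).trans (init 3 (by decide))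
    have a4 := (hfr.reg 4 (by decide)).trans (init 4 (by decide))
    have a9 := (hfr.reg 9 (by decide)).trans (init 9 (by decide))
    have a11 := (hfr.reg 11 (by decide)).trans (init 11 (by decide))
    have a12 := (hfr.reg 12 (by decide)).trans (init 12 (by decide))
    have a16 := (hfr.reg 16 (by decide)).trans (init 16 (by decide))
    have a18 := (hfr.reg 18 (by decide)).trans (init 18 (by decide))
    have hblock : block n s'.mem (s'.reg 16) = f := by
      rw [a16, block_congr hlow h16]
    have hL' : s'.reg 63 ≤ L := hA'.length_le
      ((Set.union_subset_union_right _ (nexts_mono adj inS v _ f hj.le)).trans hAB) hB hL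
    refine (tryColor_spec (n := n) (adj := adj) (inS := inS) (v := v) (L := L) s' (a0.trans h0)
      (a3.trans h3) (a9.trans h9) (by rw [a12, a4, hv]) (by omega) (by omega) (by omega)
      (fun u => by rw [a11, hlow _ (by omega), hadj]) (by rw [a12, hlow _ h12, hS])
      (by rw [a18]; exact hA') (by rw [a18, h62']) hL').seq (T₂ := 3) ?_ (by omega)
    rintro s'' hf' ⟨q1, q2, q3, q4⟩
    have b3 := hf'.reg 3 (by decide)
    have b2 := hf'.reg 2 (by decide)
    have b20 := hf'.reg 20 (by decide)
    have b21 := hf'.reg 21 (by decide)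
    rw [a18, hblock, h21, a2, Set.union_assoc, ← nexts_succ] at q1
    rw [a18] at q2
    refine .of_eval rfl le_rfl ?_
    simp only [eval, State.setReg_reg, State.setReg_mem, b3, b2, b20, b21, h21, h20, a3, a2, h3]
    simp
    refine ⟨⟨by ring, q1, q2, hb'.trans q3, fun a ha => ?_⟩, by omega⟩
    rw [q4 a (by omega), hlow a ha]

/-- Replace the listed blocks by all their extensions by a new vertex. -/
def stage : Prog :=
  (add 16 60 9 ⨾ add 17 61 9 ⨾ add 18 62 9 ⨾ const 63 0) ⨾
  loop 17 (tryColors ⨾ add 16 16 0 ⨾ sub 17 17 3) ⨾ add 60 18 9 ⨾ add 61 63 9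

/-- The new list starts where the old one ends; the old one stays in memory and is abandoned. -/
theorem stage_spec {n : ℕ} {A : Set (Fin n → ℕ)} {adj : Fin n → Prop} {inS : Prop}
    {v : Fin n} (s : State) (h0 : s.reg 0 = n) (h3 : s.reg 3 = 1) (h9 : s.reg 9 = 0)
    (hv : s.reg 12 = s.reg 4 + v) (h12 : s.reg 12 < s.reg 62) (h11 : s.reg 11 + n ≤ s.reg 62)
    (hadj : ∀ u : Fin n, adj u ↔ s.mem (s.reg 11 + u) ≠ 0) (hS : inS ↔ s.mem (s.reg 12) ≠ 0)
    (hA : Lists s.mem (s.reg 60) (s.reg 61) A)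
    (h62 : s.reg 62 = s.reg 60 + s.reg 61 * n) {L : ℕ} (hL : s.reg 61 ≤ L)
    (hB : (⋃ f ∈ A, nexts adj inS v (s.reg 1) (s.reg 2) f).Finite)
    (hBL : (⋃ f ∈ A, nexts adj inS v (s.reg 1) (s.reg 2) f).ncard ≤ L) :
    stage.HaltsWithin s (L * (s.reg 1 * ((L + 2) * (10 * n + 8) + 24) + 6) + 7) fun s' =>
      Lists s'.mem (s'.reg 60) (s'.reg 61) (⋃ f ∈ A, nexts adj inS v (s.reg 1) (s.reg 2) f) ∧
      s'.reg 62 = s'.reg 60 + s'.reg 61 * n ∧ s'.reg 60 = s.reg 62 ∧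
      ∀ a < s.reg 62, s'.mem a = s.mem a := by
  set T := s.reg 1 * ((L + 2) * (10 * n + 8) + 24) with hT
  -- The extensions of the first `i` listed codes: the contents of the new list after `i` rounds.
  set F : ℕ → Set (Fin n → ℕ) := fun i =>
    {g | ∃ i' < i, g ∈ nexts adj inS v (s.reg 1) (s.reg 2) (block n s.mem (s.reg 60 + i' * n))}
    with hF
  have hFN : F (s.reg 61) = ⋃ f ∈ A, nexts adj inS v (s.reg 1) (s.reg 2) f := by
    ext g
    simp only [hF, Set.mem_ofPred_eq, Set.mem_iUnion, hA.mem_iff, exists_prop]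
    constructor
    · rintro ⟨i, hi, hg⟩
      exact ⟨_, ⟨i, hi, rfl⟩, hg⟩
    · rintro ⟨_, ⟨i, hi, rfl⟩, hg⟩
      exact ⟨i, hi, hg⟩
  have hmul := Nat.mul_le_mul_right (T + 6) hL
  refine HaltsWithin.eval_seq rfl (T₂ := s.reg 61 * (T + 6) + 3) ?_ (by simp [cost]; omega)
  have init : ∀ r, r ∉ [16, 17, 18, 63] →
      ((add 16 60 9 ⨾ add 17 61 9 ⨾ add 18 62 9 ⨾ const 63 0).eval s).reg r = s.reg r := by
    intro r hr
    simp only [List.mem_cons, List.not_mem_nil, or_false, not_or] at hr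
    simp [eval, State.setReg_reg, hr]
  have init18 : ((add 16 60 9 ⨾ add 17 61 9 ⨾ add 18 62 9 ⨾ const 63 0).eval s).reg 18
      = s.reg 62 := by
    simp [eval, State.setReg_reg, h9]
  refine HaltsWithin.seq (HaltsWithin.loop (N := s.reg 61) (T := T + 5)
    (T' := s.reg 61 * (T + 6) + 1)
    (fun i s' => s'.reg 16 = s.reg 60 + i * n ∧
      Lists s'.mem (s.reg 62) (s'.reg 63) (F i) ∧
      s'.reg 62 = s.reg 62 + s'.reg 63 * n ∧
      ∀ a < s.reg 62, s'.mem a = s.mem a)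
    ?_ ?_ ?_ le_rfl) (T₂ := 2) ?_ (by omega)
  · simp [eval, State.setReg_reg, h9]
  · have : F 0 = ∅ := by simp [hF]
    rw [this]
    simp only [eval, State.setReg_reg, State.setReg_mem]
    simp [h9, Lists.zero]
  · rintro i hi s' ⟨h16, hA', h62', hlow⟩ h17 hfr
    have a0 := (hfr.reg 0 (by decide)).trans (init 0 (by decide))
    have a1 := (hfr.reg 1 (by decide)).trans (init 1 (by decide))
    have a2 := (hfr.reg 2 (by decide)).trans (init 2 (by decide))
    have a3 := (hfr.reg 3 (by decide)).trans (init 3 (by decide))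
    have a4 := (hfr.reg 4 (by decide)).trans (init 4 (by decide))
    have a9 := (hfr.reg 9 (by decide)).trans (init 9 (by decide))
    have a11 := (hfr.reg 11 (by decide)).trans (init 11 (by decide))
    have a12 := (hfr.reg 12 (by decide)).trans (init 12 (by decide))
    have a18 := (hfr.reg 18 (by decide)).trans init18
    have hle : s'.reg 16 + n ≤ s.reg 62 := by
      have := Nat.mul_le_mul_right n (Nat.succ_le_of_lt hi)
      grind
    have hblock : block n s'.mem (s'.reg 16) = block n s.mem (s.reg 60 + i * n) := by
      rw [block_congr hlow hle, h16]
    have hFs : F i ∪ nexts adj inS v (s.reg 1) (s.reg 2) (block n s.mem (s.reg 60 + i * n)) =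
        F (i + 1) := by
      ext g
      simp only [hF, Set.mem_union, Set.mem_ofPred_eq, Nat.exists_lt_succ_right]
    refine (tryColors_spec (n := n) (A := F i) (adj := adj) (inS := inS) (v := v) (L := L)
      (b := s.reg 62) s' (a0.trans h0)
      (a3.trans h3) (a9.trans h9) (by rw [a12, a4, hv]) (by omega) (by omega) hle (by omega)
      (fun u => by rw [a11, hlow _ (by omega), hadj]) (by rw [a12, hlow _ h12, hS])
      (by rw [a18]; exact hA') (by rw [a18, h62']) ?_ hB hBL).seq (T₂ := 2) ?_ (by rw [a1])
    · rw [hblock, a1, a2, hFs, ← hFN]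
      rintro g ⟨i', hi', hg⟩
      exact ⟨i', by omega, hg⟩
    rintro s'' hf' ⟨q1, q2, q3, q4⟩
    have b0 := hf'.reg 0 (by decide)
    have b3 := hf'.reg 3 (by decide)
    have b16 := hf'.reg 16 (by decide)
    have b17 := hf'.reg 17 (by decide)
    rw [hblock, a1, a2, hFs, a18] at q1
    rw [a18] at q2
    refine .of_eval rfl le_rfl ?_
    simp only [eval, State.setReg_reg, State.setReg_mem, b0, b3, b16, b17, h16, h17, a3, a0, h3, h0]
    simp
    refine ⟨⟨by ring, q1, q2, fun a ha => ?_⟩, by omega⟩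
    rw [q4 a ha, hlow a ha]
  · rintro s' hfr ⟨⟨-, hA', h62', hlow⟩, -⟩
    have a9 := (hfr.reg 9 (by decide)).trans (init 9 (by decide))
    have a18 := (hfr.reg 18 (by decide)).trans init18
    refine .of_eval rfl le_rfl ?_
    rw [← hFN]
    simp only [eval, State.setReg_reg, State.setReg_mem, a9, a18, h9]
    simp
    exact ⟨hA', h62', hlow⟩

/-- Process the vertex with mark at `reg 12` and adjacency row at `reg 11`, provided the mark equals
`reg 15`. -/
def passStep : Prog :=
  (load 13 12 ⨾ sub 14 13 15 ⨾ sub 13 15 13 ⨾ add 13 13 14) ⨾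
  branch 13 skip stage ⨾ add 11 11 0 ⨾ add 12 12 3 ⨾ sub 10 10 3

/-- Process all vertices whose mark equals `reg 15`. -/
def pass : Prog :=
  (add 10 0 9 ⨾ const 11 0 ⨾ add 12 4 9) ⨾ loop 10 passStep

/-- The memory at `N` holds the marks of `S` and below `N` the adjacency matrix of `G`. -/
structure Holds {n : ℕ} (G : SimpleGraph (Fin n)) (S : Finset (Fin n)) (N : ℕ) (mem : ℕ → ℕ) :
    Prop where
  adj : ∀ u v : Fin n, G.Adj v u ↔ mem (n * v + u) ≠ 0
  mark : ∀ v : Fin n, mem (N + v) = if v ∈ S then 1 else 0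

theorem Holds.congr {n : ℕ} {G : SimpleGraph (Fin n)} {S : Finset (Fin n)} {N b : ℕ}
    {mem mem' : ℕ → ℕ} (h : Holds G S N mem) (hm : ∀ a < b, mem' a = mem a) (hN : n * n ≤ N)
    (hb : N + n ≤ b) : Holds G S N mem' := by
  refine ⟨fun u v => ?_, fun v => ?_⟩
  · have := Nat.mul_le_mul_left n (Nat.succ_le_of_lt v.2)
    rw [hm _ (by grind), h.adj]
  · rw [hm _ (by omega), h.mark]

/-- The sets `A i` stay abstract, with `hstep` as the only combinatorial input. Thus one statement
covers both passes, over `S` and over its complement, selected by `w`. -/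
theorem pass_spec {n : ℕ} {G : SimpleGraph (Fin n)} {S : Finset (Fin n)} (s : State)
    (h0 : s.reg 0 = n) (h3 : s.reg 3 = 1) (h4 : s.reg 4 = n * n) (h9 : s.reg 9 = 0)
    (hs : Holds G S (n * n) s.mem) {w : Bool} (h15 : s.reg 15 = if w then 1 else 0)
    (h60 : n * n + n ≤ s.reg 60) (A : ℕ → Set (Fin n → ℕ))
    (hA : Lists s.mem (s.reg 60) (s.reg 61) (A 0)) (h62 : s.reg 62 = s.reg 60 + s.reg 61 * n)
    (hstep : ∀ v : Fin n, A (v + 1) = if (v ∈ S ↔ w = true)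
      then ⋃ f ∈ A v, nexts (G.Adj v) (v ∈ S) v (s.reg 1) (s.reg 2) f else A v)
    {L : ℕ} (hfin : ∀ i, (A i).Finite) (hL : ∀ i, (A i).ncard ≤ L) :
    pass.HaltsWithin s (n * (L * (s.reg 1 * ((L + 2) * (10 * n + 8) + 24) + 6) + 16) + 4)
      fun s' =>
      Lists s'.mem (s'.reg 60) (s'.reg 61) (A n) ∧ s'.reg 62 = s'.reg 60 + s'.reg 61 * n ∧
      n * n + n ≤ s'.reg 60 ∧ Holds G S (n * n) s'.mem := by
  set T := L * (s.reg 1 * ((L + 2) * (10 * n + 8) + 24) + 6) with hT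
  have init : ∀ r, r ∉ [10, 11, 12] →
      ((add 10 0 9 ⨾ const 11 0 ⨾ add 12 4 9).eval s).reg r = s.reg r := by
    intro r hr
    simp only [List.mem_cons, List.not_mem_nil, or_false, not_or] at hr
    simp [eval, State.setReg_reg, hr]
  refine HaltsWithin.eval_seq rfl (T₂ := n * (T + 16) + 1) ?_ (by simp [cost]; omega)
  refine (HaltsWithin.loop (N := n) (T := T + 15)
    (fun i s' => (s'.reg 11 = n * i ∧ s'.reg 12 = n * n + i) ∧
      Lists s'.mem (s'.reg 60) (s'.reg 61) (A i) ∧ s'.reg 62 = s'.reg 60 + s'.reg 61 * n ∧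
      n * n + n ≤ s'.reg 60 ∧ Holds G S (n * n) s'.mem)
    ?_ ?_ ?_ le_rfl).imp le_rfl fun s' _ h => h.1.2
  · simp [eval, State.setReg_reg, h9, h0]
  · simp only [eval, State.setReg_reg, State.setReg_mem]
    simp [h9, h4, hA, h62, h60, hs]
  · rintro i hi s' ⟨⟨h11, h12⟩, hA', h62', h60', hs'⟩ h10 hfr
    have a0 := ((hfr.reg 0 (by decide)).trans (init 0 (by decide))).trans h0
    have a1 := (hfr.reg 1 (by decide)).trans (init 1 (by decide))
    have a2 := (hfr.reg 2 (by decide)).trans (init 2 (by decide))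
    have a3 := ((hfr.reg 3 (by decide)).trans (init 3 (by decide))).trans h3
    have a4 := ((hfr.reg 4 (by decide)).trans (init 4 (by decide))).trans h4
    have a9 := ((hfr.reg 9 (by decide)).trans (init 9 (by decide))).trans h9
    have a15 := ((hfr.reg 15 (by decide)).trans (init 15 (by decide))).trans h15
    have hmark := hs'.mark ⟨i, hi⟩
    simp only at hmark
    have hstep' := hstep ⟨i, hi⟩
    simp only at hstep'
    have hle : n * i + n ≤ n * n := by
      have := Nat.mul_le_mul_left n (Nat.succ_le_of_lt hi)
      grind
    set q : Prog := load 13 12 ⨾ sub 14 13 15 ⨾ sub 13 15 13 ⨾ add 13 13 14 with hq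
    have hreg : ∀ r, r ∉ [13, 14] → (q.eval s').reg r = s'.reg r := by
      intro r hr
      simp only [List.mem_cons, List.not_mem_nil, or_false, not_or] at hr
      simp [hq, eval, State.setReg_reg, hr]
    have hmem : (q.eval s').mem = s'.mem := rfl
    -- Register 13 holds the absolute difference of the mark and `reg 15`.
    have h13 : (q.eval s').reg 13 = 0 ↔ ((⟨i, hi⟩ : Fin n) ∈ S ↔ w = true) := by
      simp only [hq, eval, State.setReg_reg]
      simp [h12, hmark, a15]
      by_cases hv : (⟨i, hi⟩ : Fin n) ∈ S <;> cases w <;> simp [hv]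
    refine HaltsWithin.eval_seq rfl (T₂ := T + 11) ?_ (by simp [cost]; omega)
    refine HaltsWithin.seq (T₁ := T + 8) (T₂ := 3) (R := fun s'' =>
      Lists s''.mem (s''.reg 60) (s''.reg 61) (A (i + 1)) ∧
      s''.reg 62 = s''.reg 60 + s''.reg 61 * n ∧
      n * n + n ≤ s''.reg 60 ∧ Holds G S (n * n) s''.mem)
      (.branch (T' := T + 7) (fun hne => ?_) (fun he => ?_) le_rfl) ?_ le_rfl
    · rw [if_neg (mt h13.2 hne)] at hstep'
      refine .of_eval rfl (by simp [cost]) ?_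
      simp only [eval, hstep']
      exact ⟨hA', h62', h60', hs'⟩
    · rw [if_pos (h13.1 he)] at hstep'
      have hr1 : (q.eval s').reg 1 = s.reg 1 := (hreg 1 (by decide)).trans a1
      have hr2 : (q.eval s').reg 2 = s.reg 2 := (hreg 2 (by decide)).trans a2
      refine (stage_spec (n := n) (A := A i) (adj := G.Adj ⟨i, hi⟩) (inS := (⟨i, hi⟩ : Fin n) ∈ S)
        (v := ⟨i, hi⟩) (L := L) (q.eval s') ((hreg 0 (by decide)).trans a0)
        ((hreg 3 (by decide)).trans a3) ((hreg 9 (by decide)).trans a9)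
        (by rw [hreg 12 (by decide), hreg 4 (by decide), h12, a4])
        (by rw [hreg 12 (by decide), hreg 62 (by decide)]; omega)
        (by rw [hreg 11 (by decide), hreg 62 (by decide)]; omega)
        (fun u => by rw [hreg 11 (by decide), hmem, h11]; exact hs'.adj u ⟨i, hi⟩)
        (by rw [hreg 12 (by decide), hmem, h12, hmark]; simp)
        (by rw [hreg 60 (by decide), hreg 61 (by decide)]; exact hA')
        (by rw [hreg 60 (by decide), hreg 61 (by decide), hreg 62 (by decide), h62'])
        (by rw [hreg 61 (by decide)]; exact hA'.length_le subset_rfl (hfin i) (hL i))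
        (by rw [hr1, hr2, ← hstep']; exact hfin _)
        (by rw [hr1, hr2, ← hstep']; exact hL _)).imp (by rw [hr1]) ?_
      rintro s'' hf' ⟨q1, q2, q3, q4⟩
      rw [hr1, hr2, ← hstep'] at q1
      rw [hreg 62 (by decide)] at q3 q4
      exact ⟨q1, q2, by omega, hs'.congr q4 le_rfl (by omega)⟩
    · rintro s'' hf' ⟨q1, q2, q3, q4⟩
      have b0 := (hf'.reg 0 (by decide)).trans ((hreg 0 (by decide)).trans a0)
      have b3 := (hf'.reg 3 (by decide)).trans ((hreg 3 (by decide)).trans a3)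
      have b10 := (hf'.reg 10 (by decide)).trans ((hreg 10 (by decide)).trans h10)
      have b11 := (hf'.reg 11 (by decide)).trans ((hreg 11 (by decide)).trans h11)
      have b12 := (hf'.reg 12 (by decide)).trans ((hreg 12 (by decide)).trans h12)
      refine .of_eval rfl le_rfl ?_
      simp only [eval, State.setReg_reg, State.setReg_mem, b0, b3, b10, b11, b12]
      simp
      refine ⟨⟨⟨by ring, by ring⟩, q1, q2, q3, q4⟩, by omega⟩

/-! ### Preparing the memory and finding a vertex cover -/

/-- Put `n * n` into `reg 4`. -/
def square : Prog :=
  (const 3 1 ⨾ const 4 0 ⨾ add 7 0 9) ⨾ loop 7 (add 4 4 0 ⨾ sub 7 7 3)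

theorem square_spec (s : State) (h9 : s.reg 9 = 0) :
    square.HaltsWithin s (3 * s.reg 0 + 4) fun s' =>
      s'.reg 3 = 1 ∧ s'.reg 4 = s.reg 0 * s.reg 0 := by
  refine HaltsWithin.eval_seq rfl (T₂ := 3 * s.reg 0 + 1) ?_ (by simp [cost]; omega)
  refine (HaltsWithin.loop (N := s.reg 0) (T := 2)
    (fun i s' => s'.reg 3 = 1 ∧ s'.reg 4 = i * s.reg 0) ?_ ?_ ?_ (by omega)).imp le_rfl
    fun s' _ h => h.1
  · simp [eval, State.setReg_reg, h9]
  · simp [eval, State.setReg_reg]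
  · rintro i hi s' ⟨h3, h4⟩ h7 hfr
    have a0 : s'.reg 0 = s.reg 0 := by rw [hfr.reg 0 (by decide)]; simp [eval, State.setReg_reg]
    refine .of_eval rfl le_rfl ?_
    simp [eval, State.setReg_reg, h3, h4, h7, a0]
    exact ⟨by ring, by omega⟩

/-- Clear `2 * n` memory cells from address `reg 4` on. -/
def clear : Prog :=
  (add 7 0 0 ⨾ add 8 4 9) ⨾ loop 7 (store 8 9 ⨾ add 8 8 3 ⨾ sub 7 7 3)

/-- The first `n` of these cells will hold the marks, and a cover supplied with the input is erased
there; the other `n` form the zero block, the code of the empty coloring. -/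
theorem clear_spec (s : State) (h3 : s.reg 3 = 1) (h9 : s.reg 9 = 0) :
    clear.HaltsWithin s (8 * s.reg 0 + 3) fun s' =>
      (∀ a < s.reg 4, s'.mem a = s.mem a) ∧
      ∀ u < 2 * s.reg 0, s'.mem (s.reg 4 + u) = 0 := by
  refine HaltsWithin.eval_seq rfl (T₂ := 8 * s.reg 0 + 1) ?_ (by simp [cost]; omega)
  refine (HaltsWithin.loop (N := 2 * s.reg 0) (T := 3)
    (fun i s' => s'.reg 8 = s.reg 4 + i ∧ (∀ a < s.reg 4, s'.mem a = s.mem a) ∧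
      ∀ u < i, s'.mem (s.reg 4 + u) = 0) ?_ ?_ ?_ (by omega)).imp le_rfl
    fun s' _ h => h.1.2
  · simp [eval, State.setReg_reg]
    omega
  · simp [eval, State.setReg_reg, State.setReg_mem, h9]
  · rintro i hi s' ⟨h8, hlow, hup⟩ h7 hfr
    have a3 : s'.reg 3 = 1 := by rw [hfr.reg 3 (by decide)]; simp [eval, State.setReg_reg, h3]
    have a9 : s'.reg 9 = 0 := by rw [hfr.reg 9 (by decide)]; simp [eval, State.setReg_reg, h9]
    refine .of_eval rfl le_rfl ?_
    simp only [Nat.forall_lt_succ_right]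
    simp [eval, State.setReg_reg, State.setReg_mem, State.setMem_reg, State.setMem_mem, a3, a9, h7,
      h8]
    refine ⟨⟨by omega, fun a ha => ?_, fun u hu _ => hup u hu⟩, by omega⟩
    rw [if_neg (by omega), hlow a ha]

/-- `S` contains at most two vertices for each vertex it shares with a vertex cover. -/
def TwoPerCover {n : ℕ} (G : SimpleGraph (Fin n)) (S : Finset (Fin n)) : Prop :=
  ∀ C : Finset (Fin n), G.IsVertexCover (C : Set (Fin n)) → S.card ≤ 2 * (C ∩ S).card

/-- A cover `C` contains an end of the new edge, and neither end was in `S`. So `C ∩ S` gains at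
least one vertex while `S` gains two. Counting `C ∩ S` makes it unnecessary to remember the
matching. -/
theorem TwoPerCover.insert_edge {n : ℕ} {G : SimpleGraph (Fin n)} {S : Finset (Fin n)}
    (h : TwoPerCover G S) {v u : Fin n} (hvu : G.Adj v u) (hv : v ∉ S) (hu : u ∉ S) :
    TwoPerCover G (insert v (insert u S)) ∧ (insert v (insert u S)).card = S.card + 2 := by
  have hcard : (insert v (insert u S)).card = S.card + 2 := by
    rw [Finset.card_insert_of_notMem (by simp [hvu.ne, hv]), Finset.card_insert_of_notMem hu]
  refine ⟨fun C hC => ?_, hcard⟩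
  have hlt : (C ∩ S).card < (C ∩ insert v (insert u S)).card := by
    refine Finset.card_lt_card ⟨by gcongr; grind, fun hsub => ?_⟩
    rcases hC hvu with hw | hw
    · have := @hsub v (by simpa using hw)
      grind
    · have := @hsub u (by simpa using hw)
      grind
  have := h C hC
  omega

/-- Add the edge between the vertices with marks at `reg 21` and `reg 23` to the matching if
possible. -/
def matchStep : Prog :=
  load 25 20 ⨾ branch 25 (load 25 21 ⨾ branch 25 skip (load 25 23 ⨾ branch 25 skip
    (store 21 3 ⨾ store 23 3 ⨾ add 6 6 3 ⨾ add 6 6 3))) skip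

theorem matchStep_spec {n : ℕ} {G : SimpleGraph (Fin n)} {S : Finset (Fin n)} (s : State)
    (h3 : s.reg 3 = 1) (hs : Holds G S (n * n) s.mem) (hS : TwoPerCover G S)
    (h6 : s.reg 6 = S.card) {v u : Fin n} (h20 : s.reg 20 = n * v + u)
    (h21 : s.reg 21 = n * n + v) (h23 : s.reg 23 = n * n + u) :
    matchStep.HaltsWithin s 10 fun s' => ∃ S', S ⊆ S' ∧ Holds G S' (n * n) s'.mem ∧
      TwoPerCover G S' ∧ s'.reg 6 = S'.card ∧ (G.Adj v u → v ∈ S' ∨ u ∈ S') ∧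
      ∀ a, n * n + n ≤ a → s'.mem a = s.mem a := by
  refine .of_eval rfl (by decide) ?_
  have hadj := hs.adj u v
  have hv := hs.mark v
  have hu := hs.mark u
  by_cases c1 : G.Adj v u
  swap
  · have : s.mem (n * v + u) = 0 := by simpa [c1] using hadj
    refine ⟨S, subset_rfl, ?_, hS, ?_, fun h => absurd h c1, ?_⟩ <;>
      simp [matchStep, eval, State.setReg_reg, State.setReg_mem, this, h20, hs, h6]
  have c1' : s.mem (n * v + u) ≠ 0 := hadj.1 c1
  by_cases c2 : v ∈ S
  · refine ⟨S, subset_rfl, ?_, hS, ?_, fun _ => .inl c2, ?_⟩ <;>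
      simp [matchStep, eval, State.setReg_reg, State.setReg_mem, c1', h20, hs, h6, h21, hv, c2]
  by_cases c3 : u ∈ S
  · refine ⟨S, subset_rfl, ?_, hS, ?_, fun _ => .inr c3, ?_⟩ <;>
      simp [matchStep, eval, State.setReg_reg, State.setReg_mem, c1', h20, hs, h6, h21, hv, c2,
        h23, hu, c3]
  obtain ⟨hS', hcard⟩ := hS.insert_edge c1 c2 c3
  have hmem : ∀ a, (matchStep.eval s).mem a =
      if a = n * n + u then 1 else if a = n * n + v then 1 else s.mem a := by
    simp [matchStep, eval, State.setReg_reg, State.setReg_mem, c1', h20, h21, hv, c2,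
        h23, hu, c3, State.setMem_mem, State.setMem_reg, h3]
  refine ⟨insert v (insert u S), by grind, ⟨fun y x => ?_, fun x => ?_⟩, hS', ?_, by simp, ?_⟩
  · have := Nat.mul_le_mul_left n (Nat.succ_le_of_lt x.2)
    rw [hmem, if_neg (by grind), if_neg (by grind), hs.adj]
  · rw [hmem, hs.mark]
    simp only [Nat.add_left_cancel_iff, ← Fin.ext_iff, Finset.mem_insert]
    split_ifs <;> grind
  · rw [hcard]
    simp [matchStep, eval, State.setReg_reg, State.setReg_mem, c1', h20, h21, hv, c2,
        h23, hu, c3, State.setMem_reg, h3, h6]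
  · intro a ha
    rw [hmem, if_neg (by omega), if_neg (by omega)]

/-- Go through the adjacency row of the vertex with mark at `reg 21`. -/
def matchRow : Prog :=
  (add 23 4 9 ⨾ add 24 0 9) ⨾ loop 24 (matchStep ⨾ add 20 20 3 ⨾ add 23 23 3 ⨾ sub 24 24 3)

/-- The marks in memory are those of a union of disjoint edges that meets all edges `v u` such
that `P v u`. -/
def Matched {n : ℕ} (G : SimpleGraph (Fin n)) (P : Fin n → Fin n → Prop) (mem₀ : ℕ → ℕ)
    (s : State) : Prop :=
  ∃ S : Finset (Fin n), Holds G S (n * n) s.mem ∧ TwoPerCover G S ∧ s.reg 6 = S.card ∧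
    (∀ v u, P v u → G.Adj v u → v ∈ S ∨ u ∈ S) ∧ ∀ a, n * n + n ≤ a → s.mem a = mem₀ a

theorem matchRow_spec {n : ℕ} {G : SimpleGraph (Fin n)} {mem₀ : ℕ → ℕ} (s : State)
    (h0 : s.reg 0 = n) (h3 : s.reg 3 = 1) (h4 : s.reg 4 = n * n) (h9 : s.reg 9 = 0)
    {i : ℕ} (hi : i < n) (h20 : s.reg 20 = n * i) (h21 : s.reg 21 = n * n + i)
    (hs : Matched G (fun v _ => v < i) mem₀ s) :
    matchRow.HaltsWithin s (14 * n + 3) fun s' =>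
      Matched G (fun v _ => v < i + 1) mem₀ s' ∧ s'.reg 20 = n * (i + 1) := by
  refine HaltsWithin.eval_seq rfl (T₂ := 14 * n + 1) ?_ (by simp [cost]; omega)
  have init : ∀ r, r ∉ [23, 24] →
      ((add 23 4 9 ⨾ add 24 0 9).eval s).reg r = s.reg r := by
    intro r hr
    simp only [List.mem_cons, List.not_mem_nil, or_false, not_or] at hr
    simp [eval, State.setReg_reg, hr]
  refine (HaltsWithin.loop (N := n) (T := 13)
    -- `reg 20` runs through the matrix without being reset, so the pairs treated so far form a
    -- lexicographic initial segment.
    (fun j s' => s'.reg 20 = n * i + j ∧ s'.reg 23 = n * n + j ∧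
      Matched G (fun v u => (v : ℕ) < i ∨ (v : ℕ) = i ∧ u < j) mem₀ s') ?_ ?_ ?_
      (by omega)).imp le_rfl ?_
  · simp [eval, State.setReg_reg, h9, h0]
  · simpa [eval, State.setReg_reg, State.setReg_mem, h9, h4, h20, Matched] using hs
  · rintro j hj s' ⟨a20, a23, S, hS, hT, h6, hP, hm⟩ h24 hfr
    have a3 := ((hfr.reg 3 (by decide)).trans (init 3 (by decide))).trans h3
    have a21 := ((hfr.reg 21 (by decide)).trans (init 21 (by decide))).trans h21
    refine (matchStep_spec s' a3 hS hT h6 (v := ⟨i, hi⟩) (u := ⟨j, hj⟩) a20 a21 a23).seq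
      (T₂ := 3) ?_ (by omega)
    rintro s'' hf' ⟨S', hSS', hS', hT', h6', hadj, hm'⟩
    have b3 := (hf'.reg 3 (by decide)).trans a3
    have b20 := (hf'.reg 20 (by decide)).trans a20
    have b23 := (hf'.reg 23 (by decide)).trans a23
    have b24 := (hf'.reg 24 (by decide)).trans h24
    refine .of_eval rfl le_rfl ?_
    refine ⟨⟨?_, ?_, S', hS', hT', ?_, fun v u hvu hvu' => ?_, fun a ha => ?_⟩, ?_⟩
    · simp [eval, State.setReg_reg, b3, b20]; ring
    · simp [eval, State.setReg_reg, b3, b23]; ring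
    · simp [eval, State.setReg_reg, h6']
    · by_cases hP' : (v : ℕ) < i ∨ (v : ℕ) = i ∧ (u : ℕ) < j
      · exact (hP v u hP' hvu').imp (@hSS' v) (@hSS' u)
      · obtain rfl : v = ⟨i, hi⟩ := Fin.ext (by simp; omega)
        obtain rfl : u = ⟨j, hj⟩ := Fin.ext (by simp; omega)
        exact hadj hvu'
    · exact (hm' a ha).trans (hm a ha)
    · simp [eval, State.setReg_reg, b3, b24]; omega
  · rintro s' hf ⟨⟨h1, -, S, hS, hT, h6, hP, hm⟩, -⟩
    exact ⟨⟨S, hS, hT, h6, fun v u hv => hP v u (by have := u.2; omega), hm⟩, by rw [h1]; ring⟩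

/-- Mark a vertex cover that consists of the ends of a maximal matching. -/
def cover : Prog :=
  (const 20 0 ⨾ add 21 4 9 ⨾ add 22 0 9 ⨾ const 6 0) ⨾
  loop 22 (matchRow ⨾ add 21 21 3 ⨾ sub 22 22 3)

/-- The last clause protects the zero block behind the marks, from which the search starts. -/
theorem cover_spec {n : ℕ} {G : SimpleGraph (Fin n)} (s : State)
    (h0 : s.reg 0 = n) (h3 : s.reg 3 = 1) (h4 : s.reg 4 = n * n) (h9 : s.reg 9 = 0)
    (hs : Holds G ∅ (n * n) s.mem) :
    cover.HaltsWithin s (n * (14 * n + 6) + 5) fun s' =>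
      ∃ S : Finset (Fin n), Holds G S (n * n) s'.mem ∧ s'.reg 6 = S.card ∧
        G.IsVertexCover (S : Set (Fin n)) ∧
        (∀ C : Finset (Fin n), G.IsVertexCover (C : Set (Fin n)) → S.card ≤ 2 * C.card) ∧
        ∀ a, n * n + n ≤ a → s'.mem a = s.mem a := by
  refine HaltsWithin.eval_seq rfl (T₂ := n * (14 * n + 6) + 1) ?_ (by simp [cost]; omega)
  have init : ∀ r, r ∉ [20, 21, 22, 6] →
      ((const 20 0 ⨾ add 21 4 9 ⨾ add 22 0 9 ⨾ const 6 0).eval s).reg r = s.reg r := by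
    intro r hr
    simp only [List.mem_cons, List.not_mem_nil, or_false, not_or] at hr
    simp [eval, State.setReg_reg, hr]
  refine (HaltsWithin.loop (N := n) (T := 14 * n + 5)
    (fun i s' => s'.reg 20 = n * i ∧ s'.reg 21 = n * n + i ∧
      Matched G (fun v _ => v < i) s.mem s') ?_ ?_ ?_
      le_rfl).imp le_rfl ?_
  · simp [eval, State.setReg_reg, h9, h0]
  · refine ⟨by simp [eval, State.setReg_reg], by simp [eval, State.setReg_reg, h4, h9], ∅, hs, ?_,
      by simp [eval, State.setReg_reg], by simp, fun _ _ => rfl⟩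
    intro C _
    simp
  · rintro i hi s' ⟨a20, a21, hM⟩ h22 hfr
    have a0 := ((hfr.reg 0 (by decide)).trans (init 0 (by decide))).trans h0
    have a3 := ((hfr.reg 3 (by decide)).trans (init 3 (by decide))).trans h3
    have a4 := ((hfr.reg 4 (by decide)).trans (init 4 (by decide))).trans h4
    have a9 := ((hfr.reg 9 (by decide)).trans (init 9 (by decide))).trans h9
    refine (matchRow_spec s' a0 a3 a4 a9 hi a20 a21 hM).seq (T₂ := 2) ?_ (by omega)
    rintro s'' hf' ⟨hM', b20⟩
    have b3 := (hf'.reg 3 (by decide)).trans a3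
    have b21 := (hf'.reg 21 (by decide)).trans a21
    have b22 := (hf'.reg 22 (by decide)).trans h22
    refine .of_eval rfl le_rfl ?_
    simp [eval, State.setReg_reg, State.setReg_mem, b3, b20, b21, b22, Matched] at hM' ⊢
    exact ⟨⟨by ring, hM'⟩, by omega⟩
  · rintro s' hf ⟨⟨-, -, S, hS, hT, h6, hP, hm⟩, -⟩
    refine ⟨S, hS, h6, fun v u hvu => hP v u v.2 hvu, fun C hC => (hT C hC).trans ?_, hm⟩
    have := Finset.card_le_card (Finset.inter_subset_left (s₁ := C) (s₂ := S))
    omega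

/-! ### Codes of partial colorings -/

section Codes

variable {n : ℕ} (G : SimpleGraph (Fin n))

open Classical in
/-- The number of neighbours of `u` in `P` that have the color of `u`. -/
noncomputable def sameDegree (P : Finset (Fin n)) (c : Fin n → ℕ) (u : Fin n) : ℕ :=
  (P.filter fun w => G.Adj u w ∧ c w = c u).card

/-- The coloring `c` has defect at most `Δ` on `P`. -/
def GoodOn (Δ : ℕ) (P : Finset (Fin n)) (c : Fin n → ℕ) : Prop :=
  ∀ u ∈ P, sameDegree G P c u ≤ Δ

/-- The code of a coloring of `P`: for the vertices of `S` in `P`, it records the color and the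
number of neighbours in `P` of the same color. -/
noncomputable def code (S : Finset (Fin n)) (Δ : ℕ) (P : Finset (Fin n)) (c : Fin n → ℕ) :
    Fin n → ℕ := fun u =>
  if u ∈ S ∧ u ∈ P then c u * (Δ + 1) + 1 + sameDegree G P c u else 0

/-- The codes of the colorings of `P` with `χ` colors and defect at most `Δ`. -/
def codes (S : Finset (Fin n)) (χ Δ : ℕ) (P : Finset (Fin n)) : Set (Fin n → ℕ) :=
  {f | ∃ c : Fin n → ℕ, (∀ u, c u < χ) ∧ GoodOn G Δ P c ∧ f = code G S Δ P c}

variable {G} {S P : Finset (Fin n)} {χ Δ : ℕ} {c : Fin n → ℕ} {v : Fin n}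

/-- In a good coloring the same-color degrees lie in `[0, Δ]`, so the windows of length `Δ + 1` of
different colors are disjoint and a code value determines the color. The value `0` of an unrecorded
vertex lies in no window. -/
theorem hit_code_iff (hc : GoodOn G Δ P c) (adj : Fin n → Prop) (j : ℕ) (u : Fin n) :
    Hit adj (j * (Δ + 1)) Δ (code G S Δ P c) u ↔ adj u ∧ u ∈ S ∧ u ∈ P ∧ c u = j := by
  unfold Hit code
  by_cases h : u ∈ S ∧ u ∈ P
  · rw [if_pos h]
    have hd := hc u h.2
    refine and_congr_right fun _ => ?_
    simp only [h.1, h.2, true_and]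
    constructor
    · rintro ⟨h1, h2⟩
      rcases lt_trichotomy (c u) j with hlt | heq | hgt
      · have := Nat.mul_le_mul_right (Δ + 1) (Nat.succ_le_of_lt hlt)
        rw [Nat.succ_mul] at this
        omega
      · exact heq
      · have := Nat.mul_le_mul_right (Δ + 1) (Nat.succ_le_of_lt hgt)
        rw [Nat.succ_mul] at this
        omega
    · rintro rfl
      omega
  · rw [if_neg h]
    constructor
    · rintro ⟨_, h1, _⟩
      omega
    · rintro ⟨_, h1, h2, _⟩
      exact absurd ⟨h1, h2⟩ h

open Classical in
theorem sameDegree_mono {P Q : Finset (Fin n)} (h : P ⊆ Q) (u : Fin n) :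
    sameDegree G P c u ≤ sameDegree G Q c u :=
  Finset.card_le_card (Finset.filter_subset_filter _ h)

open Classical in
theorem sameDegree_insert (hv : v ∉ P) (j : ℕ) {u : Fin n} (hu : u ∈ P) :
    sameDegree G (insert v P) (Function.update c v j) u =
      sameDegree G P c u + if G.Adj v u ∧ c u = j then 1 else 0 := by
  have huv : u ≠ v := fun h => hv (h ▸ hu)
  have h1 : (P.filter fun w => G.Adj u w ∧ Function.update c v j w = Function.update c v j u) =
      P.filter fun w => G.Adj u w ∧ c w = c u := by
    refine Finset.filter_congr fun w hw => ?_
    have hwv : w ≠ v := fun h => hv (h ▸ hw)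
    simp only [Function.update_of_ne hwv, Function.update_of_ne huv]
  unfold sameDegree
  rw [Finset.filter_insert, h1, Function.update_self, Function.update_of_ne huv]
  simp only [G.adj_comm u v, eq_comm (a := j)]
  split_ifs with h
  · rw [Finset.card_insert_of_notMem (by simp [hv])]
  · rfl

open Classical in
-- As all neighbours of `v` in `P` belong to `S`, the code sees each of them, and the degree of `v`
-- in its color can be read off.
theorem sameDegree_insert_self (hc : GoodOn G Δ P c) (hS : ∀ w ∈ P, G.Adj v w → w ∈ S) (j : ℕ) :
    sameDegree G (insert v P) (Function.update c v j) v =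
      hits (G.Adj v) (j * (Δ + 1)) Δ (code G S Δ P c) := by
  unfold sameDegree hits
  congr 1
  ext w
  simp only [Finset.mem_filter, Finset.mem_insert, Finset.mem_univ, true_and, hit_code_iff hc,
    Function.update_self]
  by_cases hw : w = v
  · simp [hw]
  · rw [Function.update_of_ne hw]
    grind

/-- Besides `v` itself, only its neighbours of color `j` gain a same-color neighbour. They lie in
`S`, so their codes show whether they are saturated. -/
theorem goodOn_insert_iff (hc : GoodOn G Δ P c) (hv : v ∉ P)
    (hS : ∀ w ∈ P, G.Adj v w → w ∈ S) (j : ℕ) :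
    GoodOn G Δ (insert v P) (Function.update c v j) ↔
      Extendable (G.Adj v) (j * (Δ + 1)) Δ (code G S Δ P c) := by
  unfold GoodOn Extendable
  rw [Finset.forall_mem_insert, sameDegree_insert_self hc hS]
  refine and_congr_right fun _ => ?_
  constructor
  · intro h u hu
    obtain ⟨h1, h2, h3, h4⟩ := (hit_code_iff hc _ _ _).1 hu
    have := h u h3
    rw [sameDegree_insert hv j h3, if_pos ⟨h1, h4⟩] at this
    rw [code, if_pos ⟨h2, h3⟩, h4]
    omega
  · intro h u hu
    rw [sameDegree_insert hv j hu]
    have hd := hc u hu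
    split_ifs with hh
    · have huS := hS u hu hh.1
      have := h u ((hit_code_iff hc _ _ _).2 ⟨hh.1, huS, hu, hh.2⟩)
      rw [code, if_pos ⟨huS, hu⟩, hh.2] at this
      omega
    · exact hd

theorem code_insert (hc : GoodOn G Δ P c) (hv : v ∉ P)
    (hS : ∀ w ∈ P, G.Adj v w → w ∈ S) (j : ℕ) :
    code G S Δ (insert v P) (Function.update c v j) =
      extend (G.Adj v) (v ∈ S) v (j * (Δ + 1)) Δ (code G S Δ P c) := by
  classical
  funext u
  simp only [extend, hit_code_iff hc]
  by_cases huv : u = v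
  · subst huv
    simp only [code, Finset.mem_insert, true_or, and_true, true_and, hv, and_false, if_false,
      sameDegree_insert_self hc hS, Function.update_self, false_and]
  · simp only [huv, false_and, if_false]
    by_cases hu : u ∈ S ∧ u ∈ P
    · simp only [code, Finset.mem_insert, huv, false_or, hu, true_and, and_self, if_true,
        sameDegree_insert hv j hu.2, Function.update_of_ne huv]
      split_ifs <;> omega
    · have : ¬ (G.Adj v u ∧ u ∈ S ∧ u ∈ P ∧ c u = j) := by tauto
      simp only [this, if_false, code, Finset.mem_insert, huv, false_or, hu]

/-- The recursion of the dynamic program: colorings with equal codes have the same codes of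
extensions, so one representative of each code is enough. -/
theorem codes_insert (hv : v ∉ P) (hS : ∀ w ∈ P, G.Adj v w → w ∈ S) :
    codes G S χ Δ (insert v P) =
      ⋃ f ∈ codes G S χ Δ P, nexts (G.Adj v) (v ∈ S) v χ Δ f := by
  ext g
  simp only [Set.mem_iUnion, exists_prop]
  constructor
  · rintro ⟨c, hχ, hc, rfl⟩
    have hcP : GoodOn G Δ P c := fun u hu =>
      (sameDegree_mono (Finset.subset_insert v P) u).trans (hc u (Finset.mem_insert_of_mem hu))
    refine ⟨_, ⟨c, hχ, hcP, rfl⟩, c v, hχ v, ?_, ?_⟩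
    -- Colorings are total, so `c` is the extension of itself by the color `c v`.
    · rw [← goodOn_insert_iff hcP hv hS, Function.update_eq_self]
      exact hc
    · rw [← code_insert hcP hv hS, Function.update_eq_self]
  · rintro ⟨_, ⟨c, hχ, hc, rfl⟩, j, hj, hE, rfl⟩
    refine ⟨Function.update c v j, fun u => ?_, (goodOn_insert_iff hc hv hS j).2 hE,
      (code_insert hc hv hS j).symm⟩
    by_cases h : u = v
    · simp [h, hj]
    · simp [h, hχ]

/-- Since colorings are total even for empty `P`, a color is needed for one to exist. -/
theorem codes_empty (hχ : 1 ≤ χ) : codes G S χ Δ ∅ = {fun _ => 0} := by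
  ext f
  simp only [codes, Set.mem_ofPred_eq, Set.mem_singleton_iff, GoodOn, Finset.notMem_empty]
  constructor
  · rintro ⟨c, -, -, rfl⟩
    funext u
    simp [code]
  · rintro rfl
    exact ⟨fun _ => 0, fun _ => hχ, by simp, by funext u; simp [code]⟩

theorem codes_subset : codes G S χ Δ P ⊆
    (Fintype.piFinset fun u => if u ∈ S then Finset.range (χ * (Δ + 1) + 1) else {0} :
      Finset (Fin n → ℕ)) := by
  rintro _ ⟨c, hχ, hc, rfl⟩
  rw [Finset.mem_coe, Fintype.mem_piFinset]
  intro u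
  split_ifs with hu
  · rw [Finset.mem_range, code]
    split_ifs with h
    · have h1 := hc u h.2
      have h2 := Nat.mul_le_mul_right (Δ + 1) (Nat.succ_le_of_lt (hχ u))
      rw [Nat.succ_mul] at h2
      omega
    · omega
  · simp [code, hu]

theorem finite_codes : (codes G S χ Δ P).Finite :=
  (Finset.finite_toSet _).subset codes_subset

theorem ncard_codes_le : (codes G S χ Δ P).ncard ≤ (χ * (Δ + 1) + 1) ^ S.card := by
  refine (Set.ncard_le_ncard codes_subset (Finset.finite_toSet _)).trans ?_
  rw [Set.ncard_coe_finset, Fintype.card_piFinset]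
  have : ∀ u : Fin n, (if u ∈ S then Finset.range (χ * (Δ + 1) + 1) else {0}).card =
      if u ∈ S then χ * (Δ + 1) + 1 else 1 := fun u => by split_ifs <;> simp
  simp only [this]
  rw [Finset.prod_ite]
  simp

/-- With one color `Δ` need not be bounded in terms of `S`, and the general count is useless; but
there is only one coloring. -/
theorem ncard_codes_one_le : (codes G S 1 Δ P).ncard ≤ 1 := by
  rw [Set.ncard_le_one finite_codes]
  rintro _ ⟨c, hc, -, rfl⟩ _ ⟨c', hc', -, rfl⟩
  obtain rfl : c = c' := funext fun u => by have := hc u; have := hc' u; omega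
  rfl

theorem hasDefectiveColoring_iff :
    HasDefectiveColoring G χ Δ ↔ ∃ c : Fin n → ℕ, (∀ u, c u < χ) ∧ GoodOn G Δ Finset.univ c := by
  classical
  have key : ∀ (c : Fin n → Fin χ) (i : Fin χ) (u : {v | c v = i}),
      (G.induce {v | c v = i}).degree u = sameDegree G Finset.univ (fun u => (c u : ℕ)) u := by
    intro c i u
    rw [← SimpleGraph.card_neighborFinset_eq_degree, sameDegree]
    refine Finset.card_bij (fun w _ => (w : Fin n)) ?_ ?_ ?_
    · intro w hw
      have h1 : c w = i := w.2
      have h2 : c u = i := u.2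
      simp only [SimpleGraph.mem_neighborFinset, SimpleGraph.comap_adj] at hw
      simpa [h1, h2] using hw
    · intro w _ w' _ h
      exact Subtype.ext h
    · intro w hw
      have h2 : c u = i := u.2
      simp only [Finset.mem_filter, Finset.mem_univ, true_and, ← Fin.ext_iff, h2] at hw
      exact ⟨⟨w, hw.2⟩, by simpa using hw.1, rfl⟩
  constructor
  · rintro ⟨c, hc⟩
    refine ⟨fun u => c u, fun u => (c u).2, fun u _ => ?_⟩
    have h := ((G.induce {v | c v = c u}).degree_le_maxDegree ⟨u, rfl⟩).trans
      (le_trans (le_of_eq (by congr)) (hc (c u)))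
    rwa [key c (c u) ⟨u, rfl⟩] at h
  · rintro ⟨c, hχ, hc⟩
    refine ⟨fun u => ⟨c u, hχ u⟩, fun i => ?_⟩
    refine SimpleGraph.maxDegree_le_of_forall_degree_le _ _ fun u => ?_
    have := key (fun u => ⟨c u, hχ u⟩) i u
    convert hc u (Finset.mem_univ _) using 1

theorem codes_univ_nonempty_iff :
    (codes G S χ Δ Finset.univ).Nonempty ↔ HasDefectiveColoring G χ Δ := by
  rw [hasDefectiveColoring_iff]
  exact ⟨fun ⟨_, c, h1, h2, _⟩ => ⟨c, h1, h2⟩, fun ⟨c, h1, h2⟩ => ⟨_, c, h1, h2, rfl⟩⟩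

/-! ### Parameters for which a coloring always exists -/

/-- Each vertex of `S` has a private color and the independent complement shares the color `S.card`:
no edge is monochromatic. -/
theorem hasDefectiveColoring_of_card_lt (hS : G.IsVertexCover (S : Set (Fin n)))
    (h : S.card < χ) : HasDefectiveColoring G χ Δ := by
  classical
  rw [hasDefectiveColoring_iff]
  refine ⟨fun u => if hu : u ∈ S then S.equivFin ⟨u, hu⟩ else S.card, fun u => ?_, fun u _ => ?_⟩
  · simp only
    split_ifs
    · exact (Fin.is_lt _).trans h
    · exact h
  · suffices sameDegree G Finset.univ _ u = 0 from this.trans_le (Nat.zero_le _)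
    rw [sameDegree, Finset.card_eq_zero, Finset.filter_eq_empty_iff]
    rintro w - ⟨huw, hcw⟩
    have hne := huw.ne
    rcases hS huw with hu | hw
    · rw [Finset.mem_coe] at hu
      by_cases hw : w ∈ S
      · simp only [hu, hw, dif_pos, ← Fin.ext_iff, EmbeddingLike.apply_eq_iff_eq,
          Subtype.mk.injEq] at hcw
        exact hne hcw.symm
      · simp only [hu, hw, dif_pos, dif_neg, not_false_eq_true] at hcw
        exact (Fin.is_lt _).ne hcw.symm
    · rw [Finset.mem_coe] at hw
      by_cases hu : u ∈ S
      · simp only [hu, hw, dif_pos, ← Fin.ext_iff, EmbeddingLike.apply_eq_iff_eq,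
          Subtype.mk.injEq] at hcw
        exact hne hcw.symm
      · simp only [hu, hw, dif_pos, dif_neg, not_false_eq_true] at hcw
        exact (Fin.is_lt _).ne hcw

/-- With `S` and its complement as color classes, a same-color neighbour must lie in `S`, which has
at most `Δ` vertices. -/
theorem hasDefectiveColoring_of_card_le (hS : G.IsVertexCover (S : Set (Fin n)))
    (hχ : 2 ≤ χ) (h : S.card ≤ Δ) : HasDefectiveColoring G χ Δ := by
  classical
  rw [hasDefectiveColoring_iff]
  refine ⟨fun u => if u ∈ S then 0 else 1, fun u => ?_, fun u _ => ?_⟩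
  · simp only
    split_ifs <;> omega
  · refine le_trans (Finset.card_le_card fun w hw => ?_) h
    simp only [Finset.mem_filter, Finset.mem_univ, true_and] at hw
    obtain ⟨huw, hcw⟩ := hw
    by_contra hwS
    rcases hS huw with hu | hw
    · simp [hwS, Finset.mem_coe.1 hu] at hcw
    · exact hwS hw

end Codes

/-! ### The search and its running time -/

/-- List the codes of the colorings, first of the marked vertices and then of all vertices, and
report in `reg 0` whether there are any. -/
def search : Prog :=
  (add 60 4 0 ⨾ const 61 1 ⨾ add 62 60 0 ⨾ const 15 1) ⨾ pass ⨾ const 15 0 ⨾ pass ⨾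
  branch 61 (const 0 1) (const 0 0)

theorem search_spec {n : ℕ} {G : SimpleGraph (Fin n)} {S : Finset (Fin n)} (s : State)
    (h0 : s.reg 0 = n) (h1 : 1 ≤ s.reg 1) (h3 : s.reg 3 = 1) (h4 : s.reg 4 = n * n)
    (h9 : s.reg 9 = 0) (hs : Holds G S (n * n) s.mem) (hS : G.IsVertexCover (S : Set (Fin n)))
    (hz : ∀ u < n, s.mem (n * n + n + u) = 0) {L : ℕ}
    (hL : ∀ P, (codes G S (s.reg 1) (s.reg 2) P).ncard ≤ L) :
    search.HaltsWithin s
      (2 * (n * (L * (s.reg 1 * ((L + 2) * (10 * n + 8) + 24) + 6) + 16)) + 15) fun s' =>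
      (HasDefectiveColoring G (s.reg 1) (s.reg 2) → s'.reg 0 = 1) ∧
      (¬ HasDefectiveColoring G (s.reg 1) (s.reg 2) → s'.reg 0 = 0) := by
  classical
  set T := n * (L * (s.reg 1 * ((L + 2) * (10 * n + 8) + 24) + 6) + 16) with hT
  set p : Prog := add 60 4 0 ⨾ const 61 1 ⨾ add 62 60 0 ⨾ const 15 1 with hp
  have init : ∀ r, r ∉ [60, 61, 62, 15] → (p.eval s).reg r = s.reg r := by
    intro r hr
    simp only [List.mem_cons, List.not_mem_nil, or_false, not_or] at hr
    simp [hp, eval, State.setReg_reg, hr]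
  have i1 := init 1 (by decide)
  have i2 := init 2 (by decide)
  have i60 : (p.eval s).reg 60 = n * n + n := by simp [hp, eval, State.setReg_reg, h0, h4]
  have i61 : (p.eval s).reg 61 = 1 := by simp [hp, eval, State.setReg_reg]
  have hmem : (p.eval s).mem = s.mem := rfl
  -- The vertices present after `i` rounds of the first and of the second pass.
  set P₁ : ℕ → Finset (Fin n) := fun i => S.filter fun v => (v : ℕ) < i with hP₁
  set P₂ : ℕ → Finset (Fin n) := fun i => S ∪ Finset.univ.filter fun v => (v : ℕ) < i with hP₂
  have hP₁n : P₁ n = S := by ext v; simp [hP₁]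
  have hP₂0 : P₂ 0 = S := by ext v; simp [hP₂]
  have hP₂n : P₂ n = Finset.univ := by ext v; simp [hP₂]
  have step₁ : ∀ v : Fin n, P₁ (v + 1) = if v ∈ S then insert v (P₁ v) else P₁ v := by
    intro v
    ext u
    by_cases h : u = v
    · subst h
      by_cases hu : u ∈ S <;> simp [hP₁, hu]
    · split_ifs <;> simp [hP₁, h, Ne.le_iff_lt h]
  have step₂ : ∀ v : Fin n, P₂ (v + 1) = if v ∈ S then P₂ v else insert v (P₂ v) := by
    intro v
    ext u
    by_cases h : u = v
    · subst h
      by_cases hu : u ∈ S <;> simp [hP₂, hu]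
    · split_ifs <;> simp [hP₂, h, Ne.le_iff_lt h]
  refine HaltsWithin.eval_seq rfl (T₂ := 2 * T + 11) ?_ (by simp [cost]; omega)
  refine (pass_spec (n := n) (G := G) (S := S) (p.eval s) ((init 0 (by decide)).trans h0)
    ((init 3 (by decide)).trans h3) ((init 4 (by decide)).trans h4)
    ((init 9 (by decide)).trans h9) hs (w := true) (by simp [hp, eval, State.setReg_reg])
    i60.ge (fun i => codes G S (s.reg 1) (s.reg 2) (P₁ i)) ?_
    (by simp [hp, eval, State.setReg_reg, h0, h4]) (fun v => ?_) (L := L) (fun _ => finite_codes)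
    (fun _ => hL _)).seq (T₂ := T + 7) ?_ (by rw [i1]; omega)
  -- The initial list consists of the zero block alone.
  · have : P₁ 0 = ∅ := by simp [hP₁]
    rw [this, codes_empty h1, i60, i61, hmem]
    refine ⟨fun i hi j hj _ => by omega, fun f => ?_⟩
    have : block n s.mem (n * n + n + 0 * n) = fun _ => 0 := funext fun u => by
      rw [block, Nat.zero_mul, Nat.add_zero, hz u u.2]
    simp only [Nat.lt_one_iff, exists_eq_left, this, Set.mem_singleton_iff]
    exact eq_comm
  · simp only [i1, i2, step₁, iff_true]
    split_ifs with hv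
    · exact codes_insert (by simp [hP₁]) fun w hw _ => (Finset.mem_filter.1 hw).1
    · rfl
  rintro s₁ hf₁ ⟨l₁, e62, h60, hs₁⟩
  have a0 := (hf₁.reg 0 (by decide)).trans ((init 0 (by decide)).trans h0)
  have a1 := (hf₁.reg 1 (by decide)).trans i1
  have a2 := (hf₁.reg 2 (by decide)).trans i2
  have a3 := (hf₁.reg 3 (by decide)).trans ((init 3 (by decide)).trans h3)
  have a4 := (hf₁.reg 4 (by decide)).trans ((init 4 (by decide)).trans h4)
  have a9 := (hf₁.reg 9 (by decide)).trans ((init 9 (by decide)).trans h9)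
  refine HaltsWithin.eval_seq rfl (T₂ := T + 6) ?_ (by simp [cost]; omega)
  have hreg : ∀ r, r ≠ 15 → ((const 15 0).eval s₁).reg r = s₁.reg r := fun r hr => by
    simp [eval, State.setReg_reg, hr]
  have b1 := (hreg 1 (by decide)).trans a1
  have b2 := (hreg 2 (by decide)).trans a2
  refine (pass_spec (n := n) (G := G) (S := S) ((const 15 0).eval s₁)
    ((hreg 0 (by decide)).trans a0) ((hreg 3 (by decide)).trans a3)
    ((hreg 4 (by decide)).trans a4) ((hreg 9 (by decide)).trans a9) hs₁ (w := false)
    (by simp [eval, State.setReg_reg])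
    (by rw [hreg 60 (by decide)]; exact h60) (fun i => codes G S (s.reg 1) (s.reg 2) (P₂ i)) ?_
    (by rw [hreg 60 (by decide), hreg 61 (by decide), hreg 62 (by decide), e62]) (fun v => ?_)
    (L := L) (fun _ => finite_codes) (fun _ => hL _)).seq (T₂ := 2) ?_ (by rw [b1])
  · rw [hP₁n] at l₁
    rw [hP₂0, hreg 60 (by decide), hreg 61 (by decide)]
    exact l₁
  · simp only [b1, b2, step₂, Bool.false_eq_true, iff_false]
    by_cases hv : v ∈ S
    · simp [hv]
    · simp only [hv, if_false, not_false_eq_true, if_true]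
      rw [codes_insert (by simp [hP₂, hv])]
      · simp only [hv]
      -- Here the cover property is used: a vertex outside `S` has all its neighbours in `S`.
      · exact fun w _ hvw => (hS hvw).resolve_left (by simpa using hv)
  rintro s₂ hf₂ ⟨l₂, -, -, -⟩
  rw [hP₂n] at l₂
  have hiff : s₂.reg 61 ≠ 0 ↔ HasDefectiveColoring G (s.reg 1) (s.reg 2) := by
    rw [← codes_univ_nonempty_iff (S := S)]
    constructor
    · intro h
      exact ⟨_, (l₂.mem_iff _).2 ⟨0, by omega, rfl⟩⟩
    · rintro ⟨f, hf⟩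
      obtain ⟨i, hi, -⟩ := (l₂.mem_iff f).1 hf
      omega
  refine .of_eval rfl le_rfl ?_
  rw [← hiff]
  by_cases h : s₂.reg 61 = 0 <;> simp [eval, State.setReg_reg, h]

/-- The decision program for Defective Coloring: find a vertex cover with `k` vertices, accept if
`k < χ`, or if `2 ≤ χ` and `k ≤ Δ`, and search for a coloring otherwise. -/
def solve : Prog :=
  square ⨾ clear ⨾ cover ⨾
  (sub 7 1 6 ⨾ sub 8 1 3 ⨾ branch 8 (add 8 2 3 ⨾ sub 8 8 6 ⨾ add 7 7 8) skip) ⨾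
  branch 7 (const 0 1) search

theorem search_time_le {n χ W : ℕ} (hW : 1 ≤ W) (hχ : χ ≤ W) :
    2 * (n * (W * (χ * ((W + 2) * (10 * n + 8) + 24) + 6) + 16)) + 15 ≤
      200 * W ^ 3 * (n + 1) ^ 2 := by
  refine le_trans (b := 2 * (n * (W * (W * ((W + 2) * (10 * n + 8) + 24) + 6) + 16)) + 15)
    (by gcongr) ?_
  -- In terms of `w = W - 1` the difference of the two sides has no negative coefficient.
  obtain ⟨w, rfl⟩ := Nat.exists_eq_add_of_le' hW
  zify
  rw [← sub_nonneg]
  ring_nf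
  positivity

theorem le_add_two_pow (k : ℕ) : k ≤ (k + 2) ^ (2 * k) :=
  Nat.lt_two_pow_self.le.trans <|
    (Nat.pow_le_pow_right (by omega) (by omega)).trans (Nat.pow_le_pow_left (by omega) _)

/-- For `χ ≥ 2` one has `χ(Δ+1) + 1 ≤ k² + 1 ≤ (k+2)²` with `k = S.card`. -/
theorem ncard_codes_le_pow {n χ Δ : ℕ} {G : SimpleGraph (Fin n)} {S : Finset (Fin n)}
    (hχ : 1 ≤ χ) (h : χ ≤ S.card) (h' : 2 ≤ χ → Δ < S.card) (P : Finset (Fin n)) :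
    (codes G S χ Δ P).ncard ≤ (S.card + 2) ^ (2 * S.card) := by
  rcases hχ.eq_or_lt with rfl | hχ
  · exact ncard_codes_one_le.trans (Nat.one_le_pow _ _ (by omega))
  · refine ncard_codes_le.trans ?_
    rw [pow_mul]
    refine Nat.pow_le_pow_left ?_ _
    have := Nat.mul_le_mul h (Nat.succ_le_of_lt (h' hχ))
    nlinarith

/-- Nothing is assumed about the memory outside the matrix, so both input encodings are covered. The
cover `C` serves only to bound the time. -/
theorem solve_spec {n χ Δ : ℕ} {G : SimpleGraph (Fin n)} (s : State)
    (h0 : s.reg 0 = n) (h1 : s.reg 1 = χ) (h2 : s.reg 2 = Δ) (h9 : s.reg 9 = 0)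
    (hχ : 1 ≤ χ) (hG : ∀ u v : Fin n, G.Adj v u ↔ s.mem (n * v + u) ≠ 0) {κ : ℕ}
    {C : Finset (Fin n)} (hC : G.IsVertexCover (C : Set (Fin n))) (hκ : C.card = κ) :
    solve.HaltsWithin s (300 * (2 * κ + 2) ^ (12 * κ) * (n + 1) ^ 2) fun s' =>
      (HasDefectiveColoring G χ Δ → s'.reg 0 = 1) ∧
      (¬ HasDefectiveColoring G χ Δ → s'.reg 0 = 0) := by
  set B := (2 * κ + 2) ^ (12 * κ) with hB
  have hB1 : 1 ≤ B := Nat.one_le_pow _ _ (by omega)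
  refine ((square_spec s h9).seq (T₂ := 8 * n + (n * (14 * n + 6)) +
    200 * B * (n + 1) ^ 2 + 18) ?_ le_rfl).imp ?_ fun _ _ h => h
  swap
  · rw [h0]
    zify at hB1 ⊢
    nlinarith [mul_nonneg (sub_nonneg.2 hB1) (sq_nonneg ((n : ℤ) + 1))]
  rintro s₁ hf₁ ⟨a3, a4⟩
  have a0 := (hf₁.reg 0 (by decide)).trans h0
  have a1 := (hf₁.reg 1 (by decide)).trans h1
  have a2 := (hf₁.reg 2 (by decide)).trans h2
  have a9 := (hf₁.reg 9 (by decide)).trans h9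
  rw [h0] at a4
  refine (clear_spec s₁ a3 a9).seq (T₂ := n * (14 * n + 6) + 200 * B * (n + 1) ^ 2 + 15) ?_
    (by rw [a0]; omega)
  rintro s₂ hf₂ ⟨hlow, hz⟩
  rw [a4, hf₁.mem rfl] at hlow
  rw [a4, a0] at hz
  have b0 := (hf₂.reg 0 (by decide)).trans a0
  have b1 := (hf₂.reg 1 (by decide)).trans a1
  have b2 := (hf₂.reg 2 (by decide)).trans a2
  have b3 := (hf₂.reg 3 (by decide)).trans a3
  have b4 := (hf₂.reg 4 (by decide)).trans a4
  have b9 := (hf₂.reg 9 (by decide)).trans a9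
  have hs₂ : Holds G ∅ (n * n) s₂.mem := by
    refine ⟨fun u v => ?_, fun v => by rw [hz v (by omega)]; simp⟩
    have := Nat.mul_le_mul_left n (Nat.succ_le_of_lt v.2)
    rw [hlow _ (by grind), hG]
  refine (cover_spec s₂ b0 b3 b4 b9 hs₂).seq (T₂ := 200 * B * (n + 1) ^ 2 + 10) ?_ (by omega)
  rintro s₃ hf₃ ⟨S, hs₃, h6, hS, hS2, hm₃⟩
  have c0 := (hf₃.reg 0 (by decide)).trans b0
  have c1 := (hf₃.reg 1 (by decide)).trans b1
  have c2 := (hf₃.reg 2 (by decide)).trans b2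
  have c3 := (hf₃.reg 3 (by decide)).trans b3
  have c4 := (hf₃.reg 4 (by decide)).trans b4
  have c9 := (hf₃.reg 9 (by decide)).trans b9
  have hk : S.card ≤ 2 * κ := hκ ▸ hS2 C hC
  -- Register 7 is `χ - k`, plus `Δ + 1 - k` if `χ ≥ 2`, both truncated: it vanishes exactly when
  -- neither easy case applies.
  refine HaltsWithin.seq (T₁ := 6) (T₂ := 200 * B * (n + 1) ^ 2 + 4) (R := fun s' =>
    s'.reg 7 = 0 ↔ χ ≤ S.card ∧ (2 ≤ χ → Δ < S.card)) (.of_eval rfl le_rfl ?_) ?_ (by omega)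
  · by_cases hχ1 : χ - 1 = 0
    · simp [eval, State.setReg_reg, c1, c3, hχ1, h6]
      omega
    · simp [eval, State.setReg_reg, c1, c2, c3, hχ1, h6]
      omega
  rintro s₄ hf₄ h7
  have hm₄ := hf₄.mem rfl
  refine .branch (T' := 200 * B * (n + 1) ^ 2 + 1) (fun hne => ?_) (fun he => ?_) (by omega)
  · have hyes : HasDefectiveColoring G χ Δ := by
      rw [Ne, h7] at hne
      by_cases hlt : S.card < χ
      · exact hasDefectiveColoring_of_card_lt hS hlt
      · exact hasDefectiveColoring_of_card_le hS (by omega) (by omega)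
    exact .of_eval rfl (by simp [cost]) ⟨fun _ => by simp [eval, State.setReg_reg],
      fun h => absurd hyes h⟩
  · obtain ⟨hχk, hΔk⟩ := h7.1 he
    have d1 := (hf₄.reg 1 (by decide)).trans c1
    have d2 := (hf₄.reg 2 (by decide)).trans c2
    set W := (S.card + 2) ^ (2 * S.card) with hW
    have hW1 : 1 ≤ W := Nat.one_le_pow _ _ (by omega)
    -- The exponent is `3 · 2k ≤ 12κ` because `k ≤ 2κ`.
    have hWB : W ^ 3 ≤ B := by
      rw [hW, hB, ← pow_mul]
      exact (Nat.pow_le_pow_left (by omega) _).trans (Nat.pow_le_pow_right (by omega) (by omega))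
    have hsearch := search_spec s₄ ((hf₄.reg 0 (by decide)).trans c0) (by rw [d1]; exact hχ)
      ((hf₄.reg 3 (by decide)).trans c3) ((hf₄.reg 4 (by decide)).trans c4)
      ((hf₄.reg 9 (by decide)).trans c9) (by rw [hm₄]; exact hs₃) hS
      (fun u hu => by rw [hm₄, hm₃ _ (by omega), Nat.add_assoc, hz _ (by omega)]) (L := W)
      (by rw [d1, d2]; exact ncard_codes_le_pow hχ hχk hΔk)
    rw [d1, d2] at hsearch
    refine hsearch.imp ?_ fun _ _ h => h
    refine (search_time_le hW1 (hχk.trans (le_add_two_pow _))).trans (le_trans ?_ (Nat.le_succ _))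
    gcongr

/-! ### Shape of the bounds and the input encodings -/

/-- For `κ ≥ 2` the base is at most `κ³`; the factor `4 ^ 12` is the value at `κ = 1`, where powers
of `κ` give no room. -/
theorem two_mul_add_two_pow_le (κ : ℕ) :
    (2 * κ + 2) ^ (12 * κ) ≤ 4 ^ 12 * κ ^ (36 * κ) := by
  rcases Nat.lt_or_ge κ 2 with h | h
  · interval_cases κ <;> norm_num
  · have h1 : 2 * κ + 2 ≤ κ ^ 3 := by nlinarith [Nat.pow_le_pow_left h 2]
    calc (2 * κ + 2) ^ (12 * κ) ≤ (κ ^ 3) ^ (12 * κ) := Nat.pow_le_pow_left h1 _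
      _ = κ ^ (36 * κ) := by rw [← pow_mul]; ring_nf
      _ ≤ _ := Nat.le_mul_of_pos_left _ (by norm_num)

theorem pow_mul_le_pow_mul {a b : ℕ} (κ : ℕ) (h : a ≤ b) : κ ^ (a * κ) ≤ κ ^ (b * κ) := by
  rcases Nat.eq_zero_or_pos κ with rfl | hκ
  · simp
  · exact Nat.pow_le_pow_right hκ (Nat.mul_le_mul_right _ h)

theorem mul_add_inj {n : ℕ} {i j u v : Fin n} (h : n * (v : ℕ) + u = n * i + j) :
    v = i ∧ u = j := by
  have hn : 0 < n := v.pos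
  have h1 := congrArg (· / n) h
  have h2 := congrArg (· % n) h
  simp only [Nat.mul_add_div hn, Nat.div_eq_of_lt u.2, Nat.div_eq_of_lt j.2, Nat.mul_add_mod,
    Nat.mod_eq_of_lt u.2, Nat.mod_eq_of_lt j.2, Nat.add_zero] at h1 h2
  exact ⟨Fin.ext h1, Fin.ext h2⟩

theorem adj_iff_encode (x : DCInstance) (u v : Fin x.n) :
    x.G.Adj v u ↔ x.encode.mem (x.n * v + u) ≠ 0 := by
  simp only [DCInstance.encode, ne_eq, ite_eq_right_iff, one_ne_zero, imp_false, not_not]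
  constructor
  · exact fun h => ⟨v, u, h, rfl⟩
  · rintro ⟨i, j, h, heq⟩
    obtain ⟨rfl, rfl⟩ := mul_add_inj heq
    exact h

theorem adj_iff_encode_cover (x : DCCoverInstance) (u v : Fin x.n) :
    x.G.Adj v u ↔ x.encode.mem (x.n * v + u) ≠ 0 := by
  simp only [DCCoverInstance.encode, ne_eq, ite_eq_right_iff, one_ne_zero, imp_false, not_not]
  constructor
  · exact fun h => .inl ⟨v, u, h, rfl⟩
  · rintro (⟨i, j, h, heq⟩ | ⟨i, -, heq⟩)
    · obtain ⟨rfl, rfl⟩ := mul_add_inj heq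
      exact h
    -- Marks start at `n * n`, behind every matrix cell.
    · have := Nat.mul_le_mul_left x.n (Nat.succ_le_of_lt v.2)
      have := u.2
      grind

theorem computable_bound : Computable fun k : ℕ => 300 * (2 * k + 2) ^ (12 * k) := by
  have hpow : Primrec₂ ((· ^ ·) : ℕ → ℕ → ℕ) := Primrec₂.unpaired'.1 Nat.Primrec.pow
  have hmul (a : ℕ) : Primrec fun k : ℕ => a * k :=
    Primrec.nat_mul.comp (Primrec.const a) Primrec.id
  exact ((hmul 300).comp (hpow.comp (Primrec.nat_add.comp (hmul 2) (Primrec.const 2))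
    (hmul 12))).to_comp

end DefectiveColoring

end RAM

open RAM.DefectiveColoring in
theorem theorem5 :
    DefectiveColoring.FPT ∧
    ∃ (C : ℕ) (p : RAM.Prog), DefectiveColoringWithCover.DecidedInTime p fun x =>
      C * x.S.card ^ (C * x.S.card) * (x.n + 1) ^ C := by
  constructor
  · refine ⟨_, computable_bound, 2, solve, fun x : DCInstance => ?_⟩
    obtain ⟨C, hC, hCov⟩ := x.G.vertexCoverNum_exists
    have hCov' : x.G.IsVertexCover (C.toFinite.toFinset : Set (Fin x.n)) := by
      rwa [Set.Finite.coe_toFinset]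
    refine solve_spec x.encode rfl rfl rfl rfl x.one_le_χ (adj_iff_encode x) hCov' ?_
    show C.toFinite.toFinset.card = x.G.vertexCoverNum.toNat
    rw [← hC, C.toFinite.encard_eq_coe_toFinset_card, ENat.toNat_natCast]
  -- One constant must dominate the factor `300 * 4 ^ 12` and the exponents `36` and `2`; the
  -- existential keeps the large numeral from being evaluated.
  · obtain ⟨C, hC⟩ : ∃ C : ℕ, 300 * 4 ^ 12 ≤ C := ⟨_, le_rfl⟩
    refine ⟨C, solve, fun x : DCCoverInstance => ?_⟩
    refine (solve_spec x.encode rfl rfl rfl rfl x.one_le_χ (adj_iff_encode_cover x)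
      x.isVertexCover rfl).imp ?_ fun _ _ h => h
    calc 300 * (2 * x.S.card + 2) ^ (12 * x.S.card) * (x.n + 1) ^ 2
        ≤ 300 * (4 ^ 12 * x.S.card ^ (36 * x.S.card)) * (x.n + 1) ^ 2 := by
          gcongr
          exact two_mul_add_two_pow_le _
      _ = 300 * 4 ^ 12 * x.S.card ^ (36 * x.S.card) * (x.n + 1) ^ 2 := by ring
      _ ≤ C * x.S.card ^ (C * x.S.card) * (x.n + 1) ^ C := by
          exact Nat.mul_le_mul (Nat.mul_le_mul hC (pow_mul_le_pow_mul _ (by omega)))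
            (Nat.pow_le_pow_right (by omega) (by omega))
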